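/- Let $N\in\mathbb N$ and let $\mathcal G$ be the star graph consisting of $N$ half-lines $\mathbb R_+=(0,\infty)$ joined at a common vertex $0$. Put $L^2(\mathcal G)=\bigoplus_{j=1}^N L^2(\mathbb R_+)$, $H^2(\mathcal G)=\bigoplus_{j=1}^N H^2(\mathbb R_+)$ (real- or complex-valued functions). Let $p>1$, $\alpha\in\mathbb R\setminus\{0\}$, $k\in\{1,\dots,[\tfrac{N-1}{2}]\}$ (where $[\cdot]$ is the integer part) and $\omega>\tfrac{\alpha^2}{(N-2k)^2}$. Put $a_k=\tanh^{-1}\!\Big(\tfrac{\alpha}{(2k-N)\sqrt\omega}\Big)$ and, for $x>0$, $$\varphi_{k,j}(x)=\Big[\tfrac{(p+1)\omega}{2}\,\mathrm{sech}^2\Big(\tfrac{(p-1)\sqrt\omega}{2}x\mp a_k\Big)\Big]^{\frac1{p-1}},$$ with the sign $-$ for $j=1,\dots,k$ and the sign $+$ for $j=k+1,\dots,N$. Let $\mathbf L^\alpha_{1,k}$ be the unbounded operator on $L^2(\mathcal G)$ given by $$(\mathbf L^\alpha_{1,k}\mathbf V)_j=-v_j''+\omega v_j-p\,\varphi_{k,j}^{\,p-1}v_j,\qquad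 j=1,\dots,N,$$ $$\mathrm{dom}(\mathbf L^\alpha_{1,k})=\Big\{\mathbf V=(v_j)_{j=1}^N\in H^2(\mathcal G):\ v_1(0)=\dots=v_N(0),\ \sum_{j=1}^N v_j'(0)=\alpha v_1(0)\Big\}.$$ Let $n(\mathbf L^\alpha_{1,k})$ be its Morse index, that is, the number of its negative eigenvalues counted with multiplicity. Then: (i) if $\alpha<0$, then $n(\mathbf L^\alpha_{1,k})\le k+1$; (ii) if $\alpha>0$, then $n(\mathbf L^\alpha_{1,k})\le N-k$. -/

import Mathlib

open MeasureTheory Set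

noncomputable section

namespace StarGraph

/-- Lebesgue measure on the half-line `ℝ₊ = (0, ∞)`. -/
abbrev halfLine : Measure ℝ := volume.restrict (Ioi 0)

/-- `L²(ℝ₊)` with values in `𝕜` (that is, in `ℝ` or in `ℂ`). -/
abbrev L2Half (𝕜 : Type*) [RCLike 𝕜] : Type _ := Lp 𝕜 2 halfLine

/-- `L²(𝒢) = ⊕ⱼ L²(ℝ₊)` for the star graph `𝒢` with `N` half-lines, as a Hilbert direct sum. -/
abbrev L2Star (𝕜 : Type*) [RCLike 𝕜] (N : ℕ) : Type _ := PiLp 2 (fun _ : Fin N => L2Half 𝕜)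

section Sobolev

open scoped ContDiff

variable {𝕜 : Type*} [RCLike 𝕜]

/-- `g ∈ L²(ℝ₊)` is the weak derivative of `f ∈ L²(ℝ₊)` on `(0, ∞)`. -/
def IsWeakDeriv (f g : L2Half 𝕜) : Prop :=
  ∀ φ : ℝ → ℝ, ContDiff ℝ ∞ φ → HasCompactSupport φ → tsupport φ ⊆ Ioi 0 →
    ∫ x in Ioi (0 : ℝ), deriv φ x • f x = -∫ x in Ioi (0 : ℝ), φ x • g x

lemma integrable_smul_test (f : L2Half 𝕜) {φ : ℝ → ℝ} (hφ : Continuous φ)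
    (hc : HasCompactSupport φ) : Integrable (fun x => φ x • f x) halfLine := by
  have h : MemLp φ 2 halfLine := hφ.memLp_of_hasCompactSupport hc
  exact memLp_one_iff_integrable.mp ((Lp.memLp f).smul h)

lemma integrable_smul_deriv_test (f : L2Half 𝕜) {φ : ℝ → ℝ} (hφ : ContDiff ℝ ∞ φ)
    (hc : HasCompactSupport φ) : Integrable (fun x => deriv φ x • f x) halfLine :=
  integrable_smul_test f (hφ.continuous_deriv (by simp)) hc.deriv

lemma IsWeakDeriv.add {f₁ f₂ g₁ g₂ : L2Half 𝕜} (h₁ : IsWeakDeriv f₁ g₁)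
    (h₂ : IsWeakDeriv f₂ g₂) : IsWeakDeriv (f₁ + f₂) (g₁ + g₂) := by
  intro φ hφ hc hs
  have e₁ : ∫ x in Ioi (0 : ℝ), deriv φ x • (f₁ + f₂ : L2Half 𝕜) x
      = ∫ x in Ioi (0 : ℝ), (deriv φ x • f₁ x + deriv φ x • f₂ x) := by
    refine integral_congr_ae ?_
    filter_upwards [Lp.coeFn_add f₁ f₂] with x hx
    rw [hx, Pi.add_apply, smul_add]
  have e₂ : ∫ x in Ioi (0 : ℝ), φ x • (g₁ + g₂ : L2Half 𝕜) x
      = ∫ x in Ioi (0 : ℝ), (φ x • g₁ x + φ x • g₂ x) := by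
    refine integral_congr_ae ?_
    filter_upwards [Lp.coeFn_add g₁ g₂] with x hx
    rw [hx, Pi.add_apply, smul_add]
  rw [e₁, e₂, integral_add (integrable_smul_deriv_test f₁ hφ hc)
    (integrable_smul_deriv_test f₂ hφ hc), integral_add
    (integrable_smul_test g₁ hφ.continuous hc) (integrable_smul_test g₂ hφ.continuous hc),
    h₁ φ hφ hc hs, h₂ φ hφ hc hs, neg_add]

lemma IsWeakDeriv.smul {f g : L2Half 𝕜} (c : 𝕜) (h : IsWeakDeriv f g) :
    IsWeakDeriv (c • f) (c • g) := by
  intro φ hφ hc hs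
  have e₁ : ∫ x in Ioi (0 : ℝ), deriv φ x • (c • f : L2Half 𝕜) x
      = ∫ x in Ioi (0 : ℝ), c • (deriv φ x • f x) := by
    refine integral_congr_ae ?_
    filter_upwards [Lp.coeFn_smul c f] with x hx
    rw [hx, Pi.smul_apply, smul_comm]
  have e₂ : ∫ x in Ioi (0 : ℝ), φ x • (c • g : L2Half 𝕜) x
      = ∫ x in Ioi (0 : ℝ), c • (φ x • g x) := by
    refine integral_congr_ae ?_
    filter_upwards [Lp.coeFn_smul c g] with x hx
    rw [hx, Pi.smul_apply, smul_comm]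
  rw [e₁, e₂, integral_smul, integral_smul, h φ hφ hc hs, smul_neg]

lemma IsWeakDeriv.unique {f g₁ g₂ : L2Half 𝕜} (h₁ : IsWeakDeriv f g₁)
    (h₂ : IsWeakDeriv f g₂) : g₁ = g₂ := by
  have hloc : LocallyIntegrable (fun x => (g₁ - g₂ : L2Half 𝕜) x) halfLine :=
    (Lp.memLp (g₁ - g₂)).locallyIntegrable (by norm_num)
  have key := isOpen_Ioi.ae_eq_zero_of_integral_contDiff_smul_eq_zero (U := Ioi (0 : ℝ))
    (hloc.locallyIntegrableOn _) (by
      intro φ hφ hc hs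
      have e : ∫ x in Ioi (0 : ℝ), φ x • (g₁ - g₂ : L2Half 𝕜) x
          = ∫ x in Ioi (0 : ℝ), (φ x • g₁ x - φ x • g₂ x) := by
        refine integral_congr_ae ?_
        filter_upwards [Lp.coeFn_sub g₁ g₂] with x hx
        rw [hx, Pi.sub_apply, smul_sub]
      rw [e, integral_sub (integrable_smul_test g₁ hφ.continuous hc)
        (integrable_smul_test g₂ hφ.continuous hc)]
      have := (h₁ φ hφ hc hs).symm.trans (h₂ φ hφ hc hs)
      rw [neg_inj] at this
      rw [this, sub_self])
  refine sub_eq_zero.mp (Lp.ext ?_)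
  filter_upwards [key, ae_restrict_mem measurableSet_Ioi, Lp.coeFn_zero 𝕜 2 halfLine]
    with x hx hx0 hz
  rw [hx hx0, hz, Pi.zero_apply]

/-- The Sobolev space `H¹(ℝ₊)`. -/
def IsH1 (f : L2Half 𝕜) : Prop := ∃ g, IsWeakDeriv f g

open Classical in
/-- The weak derivative of `f ∈ H¹(ℝ₊)` (and `0` for other `f`). -/
def weakDeriv (f : L2Half 𝕜) : L2Half 𝕜 := if h : IsH1 f then h.choose else 0

lemma IsH1.isWeakDeriv {f : L2Half 𝕜} (h : IsH1 f) : IsWeakDeriv f (weakDeriv f) := by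
  rw [weakDeriv, dif_pos h]
  exact h.choose_spec

lemma IsWeakDeriv.weakDeriv_eq {f g : L2Half 𝕜} (h : IsWeakDeriv f g) : weakDeriv f = g :=
  (IsH1.isWeakDeriv ⟨g, h⟩).unique h

/-- The Sobolev space `H²(ℝ₊)`. -/
def IsH2 (f : L2Half 𝕜) : Prop := IsH1 f ∧ IsH1 (weakDeriv f)

lemma IsH1.zero : IsH1 (0 : L2Half 𝕜) := by
  refine ⟨0, fun φ _ _ _ => ?_⟩
  have h : ∀ u : ℝ → ℝ, ∫ x in Ioi (0 : ℝ), u x • (0 : L2Half 𝕜) x = 0 := fun u => by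
    rw [← integral_zero ℝ 𝕜 (μ := halfLine)]
    refine integral_congr_ae ?_
    filter_upwards [Lp.coeFn_zero 𝕜 2 halfLine] with x hx
    rw [hx, Pi.zero_apply, smul_zero]
  rw [h, h, neg_zero]

lemma IsH1.add {f g : L2Half 𝕜} (hf : IsH1 f) (hg : IsH1 g) : IsH1 (f + g) :=
  ⟨_, hf.isWeakDeriv.add hg.isWeakDeriv⟩

lemma IsH1.smul {f : L2Half 𝕜} (c : 𝕜) (hf : IsH1 f) : IsH1 (c • f) :=
  ⟨_, hf.isWeakDeriv.smul c⟩

lemma weakDeriv_add {f g : L2Half 𝕜} (hf : IsH1 f) (hg : IsH1 g) :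
    weakDeriv (f + g) = weakDeriv f + weakDeriv g :=
  (hf.isWeakDeriv.add hg.isWeakDeriv).weakDeriv_eq

lemma weakDeriv_smul {f : L2Half 𝕜} (c : 𝕜) (hf : IsH1 f) :
    weakDeriv (c • f) = c • weakDeriv f :=
  (hf.isWeakDeriv.smul c).weakDeriv_eq

lemma weakDeriv_zero : weakDeriv (0 : L2Half 𝕜) = 0 := by
  have h := weakDeriv_smul (0 : 𝕜) (IsH1.zero (𝕜 := 𝕜))
  rwa [zero_smul, zero_smul] at h

/-- `f(0) = c`: the representative of `f` that is continuous on `[0, ∞)` has the value `c` at the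
vertex. (Every `f ∈ H¹(ℝ₊)` has exactly one such representative.) -/
def HasValueAtVertex (f : L2Half 𝕜) (c : 𝕜) : Prop :=
  ∃ F : ℝ → 𝕜, ContinuousOn F (Ici 0) ∧ f =ᵐ[halfLine] F ∧ F 0 = c

lemma HasValueAtVertex.zero : HasValueAtVertex (0 : L2Half 𝕜) 0 :=
  ⟨0, continuousOn_const, Lp.coeFn_zero 𝕜 2 halfLine, rfl⟩

lemma HasValueAtVertex.add {f g : L2Half 𝕜} {c d : 𝕜} (hf : HasValueAtVertex f c)
    (hg : HasValueAtVertex g d) : HasValueAtVertex (f + g) (c + d) := by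
  obtain ⟨F, hF, hfF, rfl⟩ := hf
  obtain ⟨G, hG, hgG, rfl⟩ := hg
  exact ⟨F + G, hF.add hG, (Lp.coeFn_add f g).trans (hfF.add hgG), rfl⟩

lemma HasValueAtVertex.smul {f : L2Half 𝕜} {c : 𝕜} (a : 𝕜) (hf : HasValueAtVertex f c) :
    HasValueAtVertex (a • f) (a * c) := by
  obtain ⟨F, hF, hfF, rfl⟩ := hf
  exact ⟨a • F, hF.const_smul a, (Lp.coeFn_smul a f).trans (hfF.const_smul a), rfl⟩

end Sobolev

section Operators

variable (𝕜 : Type*) [RCLike 𝕜] (N : ℕ)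

/-- The domain `D_α` of the `δ`-interaction of strength `α` at the vertex:
`V ∈ H²(𝒢)` with `v₁(0) = ⋯ = v_N(0)` and `∑ⱼ vⱼ'(0) = α v₁(0)`. -/
def deltaDomain (α : ℝ) : Submodule 𝕜 (L2Star 𝕜 N) where
  carrier := {V | (∀ j, IsH2 (V j)) ∧ ∃ (c : 𝕜) (d : Fin N → 𝕜),
    (∀ j, HasValueAtVertex (V j) c) ∧ (∀ j, HasValueAtVertex (weakDeriv (V j)) (d j)) ∧
      ∑ j, d j = (α : 𝕜) * c}
  zero_mem' := by
    refine ⟨fun j => ⟨IsH1.zero, ?_⟩, 0, 0, fun j => HasValueAtVertex.zero, fun j => ?_, by simp⟩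
    · change IsH1 (weakDeriv (0 : L2Half 𝕜))
      rw [weakDeriv_zero]
      exact IsH1.zero
    · change HasValueAtVertex (weakDeriv (0 : L2Half 𝕜)) 0
      rw [weakDeriv_zero]
      exact HasValueAtVertex.zero
  add_mem' := by
    rintro V W ⟨hV, c, d, hc, hd, hs⟩ ⟨hW, c', d', hc', hd', hs'⟩
    have e : ∀ j, weakDeriv ((V + W) j) = weakDeriv (V j) + weakDeriv (W j) :=
      fun j => weakDeriv_add (hV j).1 (hW j).1
    refine ⟨fun j => ⟨(hV j).1.add (hW j).1, ?_⟩, c + c', d + d',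
      fun j => (hc j).add (hc' j), fun j => ?_, ?_⟩
    · rw [e]
      exact (hV j).2.add (hW j).2
    · rw [e]
      exact (hd j).add (hd' j)
    · simp only [Pi.add_apply, Finset.sum_add_distrib, hs, hs', mul_add]
  smul_mem' := by
    rintro a V ⟨hV, c, d, hc, hd, hs⟩
    have e : ∀ j, weakDeriv ((a • V) j) = a • weakDeriv (V j) :=
      fun j => weakDeriv_smul a (hV j).1
    refine ⟨fun j => ⟨(hV j).1.smul a, ?_⟩, a * c, fun j => a * d j,
      fun j => (hc j).smul a, fun j => ?_, ?_⟩
    · rw [e]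
      exact (hV j).2.smul a
    · rw [e]
      exact (hd j).smul a
    · rw [← Finset.mul_sum, hs, mul_left_comm]

/-- The domain of multiplication by the potential `q = (qⱼ)`: all `V ∈ L²(𝒢)` with
`qⱼ vⱼ ∈ L²(ℝ₊)` for every `j`. It is all of `L²(𝒢)` if the `qⱼ` are bounded. -/
def potentialDomain (q : Fin N → ℝ → ℝ) : Submodule 𝕜 (L2Star 𝕜 N) where
  carrier := {V | ∀ j, MemLp (fun x => (q j x : 𝕜) * V j x) 2 halfLine}
  zero_mem' := by
    intro j
    refine (MemLp.zero (ε := 𝕜)).ae_eq ?_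
    filter_upwards [Lp.coeFn_zero 𝕜 2 halfLine] with x hx
    change (0 : 𝕜) = (q j x : 𝕜) * (0 : L2Half 𝕜) x
    rw [hx, Pi.zero_apply, mul_zero]
  add_mem' := by
    intro V W hV hW j
    refine ((hV j).add (hW j)).ae_eq ?_
    filter_upwards [Lp.coeFn_add (V j) (W j)] with x hx
    change _ = (q j x : 𝕜) * (V j + W j : L2Half 𝕜) x
    rw [hx, Pi.add_apply, Pi.add_apply, mul_add]
  smul_mem' := by
    intro a V hV j
    refine ((hV j).const_smul a).ae_eq ?_
    filter_upwards [Lp.coeFn_smul a (V j)] with x hx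
    change _ = (q j x : 𝕜) * (a • V j : L2Half 𝕜) x
    rw [hx, Pi.smul_apply, Pi.smul_apply, smul_eq_mul, smul_eq_mul, mul_left_comm]

/-- The matrix Schrödinger operator `((-d²/dx² + qⱼ) δ_{ij})` on `L²(𝒢)` with the
`δ`-interaction of strength `α` at the vertex, as an unbounded operator. -/
def schrodinger (α : ℝ) (q : Fin N → ℝ → ℝ) : L2Star 𝕜 N →ₗ.[𝕜] L2Star 𝕜 N where
  domain := deltaDomain 𝕜 N α ⊓ potentialDomain 𝕜 N q
  toFun :=
    { toFun := fun V => WithLp.toLp 2 fun j =>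
        -weakDeriv (weakDeriv (V.1 j)) + (V.2.2 j).toLp _
      map_add' := by
        intro V W
        ext1 j
        have hV := V.2.1.1 j
        have hW := W.2.1.1 j
        have e : weakDeriv (weakDeriv ((V + W).1 j))
            = weakDeriv (weakDeriv (V.1 j)) + weakDeriv (weakDeriv (W.1 j)) := by
          change weakDeriv (weakDeriv (V.1 j + W.1 j)) = _
          rw [weakDeriv_add hV.1 hW.1, weakDeriv_add hV.2 hW.2]
        have e' : ((V + W).2.2 j).toLp _ = (V.2.2 j).toLp _ + (W.2.2 j).toLp _ := by
          rw [← MemLp.toLp_add]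
          refine MemLp.toLp_congr _ _ ?_
          filter_upwards [Lp.coeFn_add (V.1 j) (W.1 j)] with x hx
          change (q j x : 𝕜) * (V.1 j + W.1 j : L2Half 𝕜) x = _
          rw [hx, Pi.add_apply, Pi.add_apply, mul_add]
        change -weakDeriv (weakDeriv ((V + W).1 j)) + ((V + W).2.2 j).toLp _ =
          (-weakDeriv (weakDeriv (V.1 j)) + (V.2.2 j).toLp _) +
            (-weakDeriv (weakDeriv (W.1 j)) + (W.2.2 j).toLp _)
        rw [e, e']
        abel
      map_smul' := by
        intro a V
        ext1 j
        have hV := V.2.1.1 j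
        have e : weakDeriv (weakDeriv ((a • V).1 j)) = a • weakDeriv (weakDeriv (V.1 j)) := by
          change weakDeriv (weakDeriv (a • V.1 j)) = _
          rw [weakDeriv_smul a hV.1, weakDeriv_smul a hV.2]
        have e' : ((a • V).2.2 j).toLp _ = a • (V.2.2 j).toLp _ := by
          rw [← MemLp.toLp_const_smul]
          refine MemLp.toLp_congr _ _ ?_
          filter_upwards [Lp.coeFn_smul a (V.1 j)] with x hx
          change (q j x : 𝕜) * (a • V.1 j : L2Half 𝕜) x = _
          rw [hx, Pi.smul_apply, Pi.smul_apply, smul_eq_mul, smul_eq_mul, mul_left_comm]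
        change -weakDeriv (weakDeriv ((a • V).1 j)) + ((a • V).2.2 j).toLp _ =
          a • (-weakDeriv (weakDeriv (V.1 j)) + (V.2.2 j).toLp _)
        rw [e, e', smul_add, smul_neg] }

end Operators

/-- `a_k = tanh⁻¹ (α / ((2k - N) √ω))`. -/
def shift (N k : ℕ) (α ω : ℝ) : ℝ := Real.artanh (α / ((2 * (k : ℝ) - N) * √ω))

/-- The profile `φ_{k,j}^α`. The edges `1, …, k` of the graph are the `j : Fin N` with
`(j : ℕ) < k`. -/
def profile (N k : ℕ) (p α ω : ℝ) (j : Fin N) (x : ℝ) : ℝ :=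
  ((p + 1) * ω / 2 *
    (1 / Real.cosh ((p - 1) * √ω / 2 * x +
      (if (j : ℕ) < k then -shift N k α ω else shift N k α ω))) ^ 2) ^ (1 / (p - 1))

/-- The potential `ω - p (φ_{k,j}^α)^{p-1}`. -/
def potential (N k : ℕ) (p α ω : ℝ) (j : Fin N) (x : ℝ) : ℝ :=
  ω - p * profile N k p α ω j x ^ (p - 1)

/-- The operator `L_{1,k}^α = ((-d²/dx² + ω - p (φ_{k,j}^α)^{p-1}) δ_{ij})` on `L²(𝒢)` with
domain `D_α`. -/
def L1 (𝕜 : Type*) [RCLike 𝕜] (N k : ℕ) (p α ω : ℝ) : L2Star 𝕜 N →ₗ.[𝕜] L2Star 𝕜 N :=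
  schrodinger 𝕜 N α (potential N k p α ω)

/-- The domain of `L_{1,k}^α` is exactly `D_α`, since the potential is bounded. -/
theorem L1_domain (𝕜 : Type*) [RCLike 𝕜] (N k : ℕ) (p α ω : ℝ) (hp : 1 < p) (hω : 0 < ω) :
    (L1 𝕜 N k p α ω).domain = deltaDomain 𝕜 N α := by
  refine inf_eq_left.mpr fun V _ j => ?_
  have hq : ∀ x, potential N k p α ω j x = ω - p * ((p + 1) * ω / 2 *
      (1 / Real.cosh ((p - 1) * √ω / 2 * x +
        (if (j : ℕ) < k then -shift N k α ω else shift N k α ω))) ^ 2) := by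
    intro x
    have h0 : 0 < p - 1 := by linarith
    rw [potential, profile, ← Real.rpow_mul (by positivity), one_div_mul_cancel h0.ne',
      Real.rpow_one]
  have hcont : Continuous (potential N k p α ω j) := by
    rw [funext hq]
    have hc : ∀ y : ℝ, Real.cosh y ≠ 0 := fun y => (Real.cosh_pos y).ne'
    refine continuous_const.sub (continuous_const.mul (continuous_const.mul
      ((continuous_const.div (Real.continuous_cosh.comp (by fun_prop)) fun y => hc _).pow 2)))
  have hbound : ∀ x, |potential N k p α ω j x| ≤ ω + p * ((p + 1) * ω / 2) := by
    intro x
    rw [hq]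
    set y := (p - 1) * √ω / 2 * x + (if (j : ℕ) < k then -shift N k α ω else shift N k α ω)
    have h1 : 0 ≤ (1 / Real.cosh y) ^ 2 := by positivity
    have h2 : (1 / Real.cosh y) ^ 2 ≤ 1 := by
      have h3 : 1 / Real.cosh y ≤ 1 := by
        rw [div_le_one (Real.cosh_pos y)]
        exact Real.one_le_cosh y
      have h4 : 0 ≤ 1 / Real.cosh y := by have := Real.cosh_pos y; positivity
      nlinarith
    have h5 : 0 ≤ (p + 1) * ω / 2 := by positivity
    have h6 : 0 ≤ p * ((p + 1) * ω / 2 * (1 / Real.cosh y) ^ 2) := by positivity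
    have h7 : p * ((p + 1) * ω / 2 * (1 / Real.cosh y) ^ 2) ≤ p * ((p + 1) * ω / 2) := by
      have h8 := mul_le_mul_of_nonneg_left h2 h5
      have h9 := mul_le_mul_of_nonneg_left h8 (by linarith : 0 ≤ p)
      linarith
    rw [abs_le]
    constructor <;> linarith
  refine (Lp.memLp (V j)).of_le_mul (c := ω + p * ((p + 1) * ω / 2))
    ((RCLike.continuous_ofReal.comp hcont).aestronglyMeasurable.mul
      (Lp.aestronglyMeasurable (V j))) (ae_of_all _ fun x => ?_)
  rw [norm_mul, RCLike.norm_ofReal]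
  exact mul_le_mul_of_nonneg_right (hbound x) (norm_nonneg _)

section MorseIndex

variable {𝕜 E : Type*} [RCLike 𝕜] [NormedAddCommGroup E] [InnerProductSpace 𝕜 E]

/-- The eigenspace `ker (A - l I)` of an unbounded operator `A`. -/
def eigenspace (A : E →ₗ.[𝕜] E) (l : ℝ) : Submodule 𝕜 E where
  carrier := {v | ∃ h : v ∈ A.domain, A ⟨v, h⟩ = (l : 𝕜) • v}
  zero_mem' := ⟨A.domain.zero_mem, by
    rw [smul_zero]
    exact A.map_zero⟩
  add_mem' := by
    rintro v w ⟨hv, ev⟩ ⟨hw, ew⟩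
    refine ⟨A.domain.add_mem hv hw, ?_⟩
    rw [smul_add, ← ev, ← ew, ← A.map_add]
    rfl
  smul_mem' := by
    rintro a v ⟨hv, ev⟩
    refine ⟨A.domain.smul_mem a hv, ?_⟩
    rw [smul_comm, ← ev, ← A.map_smul]
    rfl

/-- The Morse index `n(A)`: the number of negative eigenvalues of `A`, counted with multiplicity,
that is, the sum of `dim ker (A - l I)` over all `l < 0`, as an element of `{0, 1, 2, …, ∞}`. -/
def morseIndex (A : E →ₗ.[𝕜] E) : ℕ∞ :=
  ⨆ s : Finset (Iio (0 : ℝ)), ∑ l ∈ s, Cardinal.toENat (Module.rank 𝕜 (eigenspace A (l : ℝ)))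

end MorseIndex

end StarGraph

end

noncomputable section

namespace StarGraph

/-! ### Regularity: from weak derivatives in L² to classical solutions -/

section WeakDerivatives

open scoped ContDiff

variable {𝕜 : Type*} [RCLike 𝕜]

/-! The Morse index is at most the number of point conditions that make the quadratic form
nonnegative: if the form is nonnegative on all combinations of negative eigenvectors vanishing at m
given points, evaluation at these points is injective on every finite sum of negative eigenspaces,
whose dimension is then at most m (`morseIndex_le_card`, `morseIndex_schrodinger_le_card`).

The points come from Jacobi's factorization. With β = (p-1)√ω/2 and σ = √ω, the potential q on each
edge is of Pöschl–Teller type, and the derivative φ' of the profile solves ψ'' = qψ. Its logarithmic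
derivative r = φ''/φ' satisfies r' = q - r², whence Re(F̄(-F'' + qF)) = |F' - rF|² - (Re(F̄F') -
r|F|²)'. Integration over the edge bounds the form below by Re(F̄F')(0) - r(0)|F(0)|²
(`IsC2Rep.boundaryForm_le_integral`). The only obstruction is a zero of φ' inside the edge, where r
has a pole; it is harmless if F vanishes there. Summed over the edges, the vertex condition leaves
(α - ∑ r_j(0))|c|², with c the common vertex value (`IsClassicalPair.re_inner_nonneg`).

If α < 0, then a_k > 0 and φ' has a zero exactly on the first k edges; these k points together with
the vertex (to force c = 0) give k + 1 conditions. If α > 0, then a_k < 0, the zeros lie on the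
other N - k edges, and ∑ r_j(0) ≤ α (`sum_riccati_edgeShift_le`), so the vertex condition is not
needed.

All this requires eigenvectors, given only through weak derivatives, to be classical solutions
(`IsH2.exists_isC2Rep`). -/

lemma exists_Icc_of_test {φ : ℝ → ℝ} (hc : HasCompactSupport φ) (hs : tsupport φ ⊆ Ioi 0) :
    ∃ δ R : ℝ, 0 < δ ∧ δ < R ∧ ∀ x, x ∉ Icc δ R → φ x = 0 := by
  rcases (tsupport φ).eq_empty_or_nonempty with h | h
  · refine ⟨1, 2, by norm_num, by norm_num, fun x _ => ?_⟩
    exact image_eq_zero_of_notMem_tsupport (by simp [h])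
  · obtain ⟨a, ha, ha'⟩ := hc.exists_isLeast h
    obtain ⟨b, hb, hb'⟩ := hc.exists_isGreatest h
    -- The extra 1 keeps the interval nondegenerate even if the support is a single point.
    refine ⟨a, b + 1, hs ha, by linarith [ha' hb], fun x hx => ?_⟩
    refine image_eq_zero_of_notMem_tsupport fun hx' => hx ⟨ha' hx', ?_⟩
    linarith [hb' hx']

lemma integral_Ioi_eq_intervalIntegral {E : Type*} [NormedAddCommGroup E] [NormedSpace ℝ E]
    {u : ℝ → E} {R : ℝ} (hR : 0 ≤ R) (h : ∀ x, R < x → u x = 0) :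
    ∫ x in Ioi (0 : ℝ), u x = ∫ x in (0 : ℝ)..R, u x := by
  rw [intervalIntegral.integral_of_le hR]
  refine (setIntegral_eq_of_subset_of_forall_sdiff_eq_zero measurableSet_Ioi
    (fun x hx => hx.1) fun x hx => h x ?_)
  by_contra hx'
  exact hx.2 ⟨hx.1, not_lt.mp hx'⟩

lemma intervalIntegrable_of_locallyIntegrable {E : Type*} [NormedAddCommGroup E] {g : ℝ → E}
    (hg : LocallyIntegrable g) (a b : ℝ) : IntervalIntegrable g volume a b :=
  intervalIntegrable_iff.mpr
    ((hg.integrableOn_isCompact isCompact_uIcc).mono_set uIoc_subset_uIcc)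

/-- A primitive of a locally integrable function has that function as weak derivative. -/
lemma integral_deriv_smul_primitive {g : ℝ → 𝕜} (hg : LocallyIntegrable g) {φ : ℝ → ℝ}
    (hφ : ContDiff ℝ ∞ φ) (hc : HasCompactSupport φ) (hs : tsupport φ ⊆ Ioi 0) :
    ∫ x in Ioi (0 : ℝ), deriv φ x • (∫ t in (0 : ℝ)..x, g t)
      = -∫ x in Ioi (0 : ℝ), φ x • g x := by
  obtain ⟨δ, R, hδ, hR, h0⟩ := exists_Icc_of_test hc hs
  have hR0 : (0 : ℝ) ≤ R := by linarith
  have hii : ∀ a b : ℝ, IntervalIntegrable g volume a b :=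
    intervalIntegrable_of_locallyIntegrable hg
  have hφc : Continuous φ := hφ.continuous
  have hφ'c : Continuous (deriv φ) := hφ.continuous_deriv (by simp)
  have hP : Continuous fun x => ∫ t in (0 : ℝ)..x, g t :=
    intervalIntegral.continuous_primitive hii 0
  have hd : ∀ x, R < x → deriv φ x = 0 := by
    intro x hx
    have : φ =ᶠ[nhds x] fun _ => 0 := by
      filter_upwards [Ioi_mem_nhds hx] with y hy
      exact h0 y fun h => absurd h.2 (not_le.mpr hy)
    rw [this.deriv_eq, deriv_const]
  rw [integral_Ioi_eq_intervalIntegral hR0 fun x hx => by rw [hd x hx, zero_smul],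
    integral_Ioi_eq_intervalIntegral hR0 fun x hx => by
      rw [h0 x fun h => absurd h.2 (not_le.mpr hx), zero_smul]]
  have hI1 : IntervalIntegrable (fun x => deriv φ x • (∫ t in (0 : ℝ)..x, g t)) volume 0 R :=
    (hφ'c.smul hP).intervalIntegrable _ _
  have hI2 : IntervalIntegrable (fun x => φ x • g x) volume 0 R :=
    (hii 0 R).continuousOn_smul hφc.continuousOn
  -- Integration by parts is done for real-valued absolutely continuous functions, the primitive of
  -- g being no better than that; the real and imaginary parts then give the claim in 𝕜.
  have key : ∀ L : 𝕜 →L[ℝ] ℝ, L (∫ x in (0 : ℝ)..R, deriv φ x • (∫ t in (0 : ℝ)..x, g t))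
      = L (-∫ x in (0 : ℝ)..R, φ x • g x) := by
    intro L
    rw [map_neg, ← L.intervalIntegral_comp_comm hI1, ← L.intervalIntegral_comp_comm hI2]
    have hLg : ∀ a b : ℝ, IntervalIntegrable (fun x => L (g x)) volume a b := fun a b =>
      ⟨L.integrable_comp (hii a b).1, L.integrable_comp (hii a b).2⟩
    have hac : AbsolutelyContinuousOnInterval φ 0 R :=
      (hφ.of_le (by simp)).contDiffOn.absolutelyContinuousOnInterval
    have hac' := (hLg 0 R).absolutelyContinuousOnInterval_intervalIntegral (c := 0) (by simp)
    have hp := hac.integral_mul_deriv_eq_deriv_mul hac'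
    rw [h0 0 fun h => absurd h.1 (not_le.mpr hδ)] at hp
    have e1 : ∫ x in (0 : ℝ)..R, L (φ x • g x)
        = ∫ x in (0 : ℝ)..R, φ x * deriv (fun x => ∫ t in (0 : ℝ)..x, L (g t)) x := by
      refine intervalIntegral.integral_congr_ae ?_
      filter_upwards [(hLg 0 R).ae_hasDerivAt_integral] with x hx hx'
      rw [(hx (uIoc_subset_uIcc hx') 0 (by simp)).deriv, map_smul, smul_eq_mul]
    have e2 : ∫ x in (0 : ℝ)..R, L (deriv φ x • ∫ t in (0 : ℝ)..x, g t)
        = ∫ x in (0 : ℝ)..R, deriv φ x * ∫ t in (0 : ℝ)..x, L (g t) := by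
      refine intervalIntegral.integral_congr fun x _ => ?_
      simp only [map_smul, smul_eq_mul]
      rw [L.intervalIntegral_comp_comm (hii 0 x)]
    -- R itself belongs to the interval, so φ R = 0 needs continuity from the right.
    have hφR : φ R = 0 := by
      have h1 : Filter.Tendsto φ (nhdsWithin R (Ioi R)) (nhds (φ R)) :=
        hφc.continuousAt.tendsto.mono_left nhdsWithin_le_nhds
      refine tendsto_nhds_unique h1 (tendsto_const_nhds.congr' ?_)
      filter_upwards [self_mem_nhdsWithin] with y hy
      exact (h0 y fun h => absurd h.2 (not_le.mpr hy)).symm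
    rw [hφR] at hp
    rw [e1, e2, hp]
    ring
  refine RCLike.ext ?_ ?_
  · exact key RCLike.reCLM
  · exact key RCLike.imCLM

/-- A function on `(0, ∞)` whose weak derivative vanishes is constant. -/
lemma ae_eq_const_of_integral_deriv_smul_eq_zero {h : ℝ → 𝕜} (hl : LocallyIntegrable h halfLine)
    (h0 : ∀ φ : ℝ → ℝ, ContDiff ℝ ∞ φ → HasCompactSupport φ → tsupport φ ⊆ Ioi 0 →
      ∫ x in Ioi (0 : ℝ), deriv φ x • h x = 0) :
    ∃ c : 𝕜, h =ᵐ[halfLine] fun _ => c := by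
  -- The bump is supported in [1, 3], hence away from the vertex. The constant will be the average
  -- of h against it.
  let b : ContDiffBump (2 : ℝ) := ⟨1 / 2, 1, by norm_num, by norm_num⟩
  set η : ℝ → ℝ := b.normed volume with hη
  have hηs : ContDiff ℝ ∞ η := b.contDiff_normed
  have hηc : HasCompactSupport η := b.hasCompactSupport_normed
  have hηt : tsupport η ⊆ Ioi 0 := by
    rw [hη, b.tsupport_normed_eq]
    intro x hx
    have := abs_le.mp (by simpa [Real.dist_eq] using hx : |x - 2| ≤ 1)
    simp only [mem_Ioi]; linarith [this.1]
  have hη1 : ∫ x, η x = 1 := b.integral_normed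
  have hint : ∀ φ : ℝ → ℝ, Continuous φ → HasCompactSupport φ →
      Integrable (fun x => φ x • h x) halfLine := fun φ h1 h2 =>
    hl.integrable_smul_left_of_hasCompactSupport h1 h2
  set c : 𝕜 := ∫ x in Ioi (0 : ℝ), η x • h x with hcdef
  refine ⟨c, ?_⟩
  have hloc : LocallyIntegrable (fun x => h x - c) halfLine :=
    hl.sub (locallyIntegrable_const c)
  have key := isOpen_Ioi.ae_eq_zero_of_integral_contDiff_smul_eq_zero (U := Ioi (0 : ℝ))
    (hloc.locallyIntegrableOn _) (by
      intro φ hφ hc hs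
      set m : ℝ := ∫ x, φ x with hm
      -- Du Bois-Reymond's argument: ψ has mean zero, so its primitive Ψ is again a test function,
      -- and ψ = Ψ' may be inserted in `h0`.
      set ψ : ℝ → ℝ := fun x => φ x - m * η x with hψ
      have hψs : ContDiff ℝ ∞ ψ := hφ.sub (contDiff_const.mul hηs)
      have hφi : Integrable φ := hφ.continuous.integrable_of_hasCompactSupport hc
      have hηi : Integrable η := hηs.continuous.integrable_of_hasCompactSupport hηc
      have hψi : ∫ x, ψ x = 0 := by
        rw [hψ, integral_sub hφi (hηi.const_mul m), integral_const_mul, hη1]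
        simp [hm]
      obtain ⟨δ₁, R₁, hδ₁, hR₁, h₁⟩ := exists_Icc_of_test hc hs
      obtain ⟨δ₂, R₂, hδ₂, hR₂, h₂⟩ := exists_Icc_of_test hηc hηt
      have hψ0 : ∀ x, x ∉ Icc (min δ₁ δ₂) (max R₁ R₂) → ψ x = 0 := by
        intro x hx
        have e1 : φ x = 0 := h₁ x fun h => hx
          ⟨(min_le_left _ _).trans h.1, h.2.trans (le_max_left _ _)⟩
        have e2 : η x = 0 := h₂ x fun h => hx
          ⟨(min_le_right _ _).trans h.1, h.2.trans (le_max_right _ _)⟩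
        simp [hψ, e1, e2]
      have hδ : 0 < min δ₁ δ₂ := lt_min hδ₁ hδ₂
      set δ := min δ₁ δ₂
      set R := max R₁ R₂
      set Ψ : ℝ → ℝ := fun x => ∫ t in (0 : ℝ)..x, ψ t with hΨ
      have hder : ∀ x, HasDerivAt Ψ (ψ x) x := fun x =>
        intervalIntegral.integral_hasDerivAt_right (hψs.continuous.intervalIntegrable _ _)
          (hψs.continuous.stronglyMeasurableAtFilter _ _) hψs.continuous.continuousAt
      have hderiv : deriv Ψ = ψ := funext fun x => (hder x).deriv
      have hΨs : ContDiff ℝ ∞ Ψ := by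
        rw [contDiff_infty_iff_deriv, hderiv]
        exact ⟨fun x => (hder x).differentiableAt, hψs⟩
      have hΨ0 : ∀ x, x ∉ Icc δ R → Ψ x = 0 := by
        intro x hx
        by_cases hx1 : x < δ
        · have : ∫ t in (0 : ℝ)..x, ψ t = ∫ t in (0 : ℝ)..x, (0 : ℝ) := by
            refine intervalIntegral.integral_congr fun t ht => hψ0 t fun h => ?_
            have : t ≤ max 0 x := ht.2
            have := max_lt hδ hx1
            linarith [h.1]
          rw [hΨ]
          simp only [this, intervalIntegral.integral_zero]
        · have hx2 : R < x := by
            by_contra h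
            exact hx ⟨not_lt.mp hx1, not_lt.mp h⟩
          have hx0 : 0 ≤ x := hδ.le.trans (not_lt.mp hx1)
          rw [hΨ]
          simp only
          rw [← integral_Ioi_eq_intervalIntegral hx0 fun y hy => hψ0 y fun h =>
            absurd h.2 (not_le.mpr (hx2.trans hy))]
          refine Eq.trans ?_ hψi
          refine setIntegral_eq_integral_of_forall_compl_eq_zero fun y hy => hψ0 y fun h => ?_
          exact hy (hδ.trans_le h.1)
      have hΨts : tsupport Ψ ⊆ Icc δ R := closure_minimal
        (fun x hx => by_contra fun h => hx (hΨ0 x h)) isClosed_Icc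
      have hΨc : HasCompactSupport Ψ :=
        isCompact_Icc.of_isClosed_subset (isClosed_tsupport _) hΨts
      have hz := h0 Ψ hΨs hΨc fun x hx => hδ.trans_le (hΨts hx).1
      rw [hderiv] at hz
      have e1 : ∫ x in Ioi (0 : ℝ), ψ x • h x
          = (∫ x in Ioi (0 : ℝ), φ x • h x) - m • c := by
        rw [hcdef, ← integral_smul, ← integral_sub (hint φ hφ.continuous hc)
          (g := fun x => m • η x • h x) ((hint η hηs.continuous hηc).smul m)]
        refine integral_congr_ae (ae_of_all _ fun x => ?_)
        simp only [hψ, sub_smul, mul_smul]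
      have e2 : ∫ x in Ioi (0 : ℝ), φ x • (h x - c)
          = (∫ x in Ioi (0 : ℝ), φ x • h x) - m • c := by
        have : ∫ x in Ioi (0 : ℝ), φ x = m := by
          refine setIntegral_eq_integral_of_forall_compl_eq_zero fun y hy => h₁ y fun h => ?_
          exact hy (hδ₁.trans_le h.1)
        rw [← this, ← integral_smul_const, ← integral_sub (hint φ hφ.continuous hc)
          (hφi.integrableOn.smul_const c)]
        refine integral_congr_ae (ae_of_all _ fun x => ?_)
        simp only [smul_sub]
      rw [e2, ← e1, hz])
  filter_upwards [key, ae_restrict_mem measurableSet_Ioi] with x hx hx0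
  exact sub_eq_zero.mp (hx hx0)

/-- Extension by zero makes primitives based at the vertex continuous on all of ℝ. -/
lemma locallyIntegrable_indicator (g : L2Half 𝕜) :
    LocallyIntegrable ((Ioi (0 : ℝ)).indicator g) := by
  have : MemLp ((Ioi (0 : ℝ)).indicator g) 2 volume :=
    (memLp_indicator_iff_restrict measurableSet_Ioi).mpr (Lp.memLp g)
  exact this.locallyIntegrable (by norm_num)

lemma primitive_congr {g G : ℝ → 𝕜} (h : g =ᵐ[halfLine] G) {x : ℝ} (hx : 0 ≤ x) :
    ∫ t in (0 : ℝ)..x, g t = ∫ t in (0 : ℝ)..x, G t := by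
  refine intervalIntegral.integral_congr_ae ?_
  filter_upwards [(ae_restrict_iff' measurableSet_Ioi).mp h] with t ht ht'
  rw [uIoc_of_le hx] at ht'
  exact ht ht'.1

/-- A function with a weak derivative in `L²(ℝ₊)` is a primitive of that derivative. -/
lemma IsWeakDeriv.exists_primitive {f g : L2Half 𝕜} (h : IsWeakDeriv f g) :
    ∃ c : 𝕜, f =ᵐ[halfLine] fun x => c + ∫ t in (0 : ℝ)..x, (Ioi (0 : ℝ)).indicator g t := by
  have hg := locallyIntegrable_indicator g
  set P : ℝ → 𝕜 := fun x => ∫ t in (0 : ℝ)..x, (Ioi (0 : ℝ)).indicator g t with hP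
  have hPc : Continuous P :=
    intervalIntegral.continuous_primitive (fun a b => intervalIntegrable_of_locallyIntegrable hg a b) 0
  have hfl : LocallyIntegrable f halfLine := (Lp.memLp f).locallyIntegrable (by norm_num)
  obtain ⟨c, hc⟩ := ae_eq_const_of_integral_deriv_smul_eq_zero
    (h := fun x => f x - P x) (hfl.sub hPc.locallyIntegrable) (by
      intro φ hφ hc hs
      have e := integral_deriv_smul_primitive hg hφ hc hs
      have e' : ∫ x in Ioi (0 : ℝ), φ x • (Ioi (0 : ℝ)).indicator g x
          = ∫ x in Ioi (0 : ℝ), φ x • g x := by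
        refine setIntegral_congr_fun measurableSet_Ioi fun x hx => ?_
        simp only [indicator_of_mem hx]
      rw [e', ← h φ hφ hc hs] at e
      have hPi : Integrable (fun x => deriv φ x • P x) halfLine :=
        (((hφ.continuous_deriv (by simp)).smul hPc).integrable_of_hasCompactSupport
          hc.deriv.smul_right).integrableOn
      have e2 : ∫ x in Ioi (0 : ℝ), deriv φ x • (f x - P x)
          = ∫ x in Ioi (0 : ℝ), (deriv φ x • f x - deriv φ x • P x) := by simp only [smul_sub]
      rw [e2, integral_sub (integrable_smul_deriv_test f hφ hc) hPi, e, sub_self])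
  refine ⟨c, ?_⟩
  filter_upwards [hc] with x hx
  rw [← hx]
  ring

lemma IsWeakDeriv.exists_primitive_of_ae_eq {f g : L2Half 𝕜} (h : IsWeakDeriv f g)
    {G : ℝ → 𝕜} (hG : g =ᵐ[halfLine] G) :
    ∃ c : 𝕜, f =ᵐ[halfLine] fun x => c + ∫ t in (0 : ℝ)..x, G t := by
  obtain ⟨c, hc⟩ := h.exists_primitive
  refine ⟨c, ?_⟩
  filter_upwards [hc, ae_restrict_mem measurableSet_Ioi] with x hx hx0
  rw [hx, primitive_congr _ hx0.le]
  filter_upwards [hG, ae_restrict_mem measurableSet_Ioi] with t ht ht0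
  rw [indicator_of_mem ht0, ht]

/-- `F` is a twice continuously differentiable representative of `f`, with `F' = G`, `F'' = H`
in `L²(ℝ₊)`. -/
structure IsC2Rep (f : L2Half 𝕜) (F G H : ℝ → 𝕜) : Prop where
  ae_eq : f =ᵐ[halfLine] F
  hasDerivAt : ∀ x, HasDerivAt F (G x) x
  hasDerivAt' : ∀ x, HasDerivAt G (H x) x
  continuous : Continuous H
  memLp' : MemLp G 2 halfLine
  memLp'' : MemLp H 2 halfLine

lemma hasDerivAt_primitive {G : ℝ → 𝕜} (hG : Continuous G) (c : 𝕜) (x : ℝ) :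
    HasDerivAt (fun x => c + ∫ t in (0 : ℝ)..x, G t) (G x) x :=
  (intervalIntegral.integral_hasDerivAt_right (hG.intervalIntegrable _ _)
    (hG.stronglyMeasurableAtFilter _ _) hG.continuousAt).const_add c

/-- A weak solution `f ∈ L²(ℝ₊)` of `f'' = Q f` with `Q` continuous is a classical solution. -/
lemma IsH2.exists_isC2Rep {f : L2Half 𝕜} (hf : IsH2 f) {Q : ℝ → ℝ} (hQ : Continuous Q)
    (h : weakDeriv (weakDeriv f) =ᵐ[halfLine] fun x => (Q x : 𝕜) * f x) :
    ∃ F G H : ℝ → 𝕜, IsC2Rep f F G H ∧ weakDeriv f =ᵐ[halfLine] G ∧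
      H =ᵐ[halfLine] fun x => (Q x : 𝕜) * F x := by
  obtain ⟨c, hc⟩ := hf.1.isWeakDeriv.exists_primitive
  set F₀ : ℝ → 𝕜 :=
    fun x => c + ∫ t in (0 : ℝ)..x, (Ioi (0 : ℝ)).indicator (weakDeriv f) t
  have hF₀ : Continuous F₀ := continuous_const.add (intervalIntegral.continuous_primitive
    (fun a b => intervalIntegrable_of_locallyIntegrable (locallyIntegrable_indicator _) a b) 0)
  -- Bootstrap: f has a continuous representative, so f'' = Qf has one too; integrating it twice
  -- gives a C² function on all of ℝ, with two-sided derivatives at the vertex.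
  have hH : Continuous fun x => (Q x : 𝕜) * F₀ x :=
    (RCLike.continuous_ofReal.comp hQ).mul hF₀
  have hH' : weakDeriv (weakDeriv f) =ᵐ[halfLine] fun x => (Q x : 𝕜) * F₀ x := by
    filter_upwards [h, hc] with x h1 h2
    rw [h1, h2]
  obtain ⟨d, hd⟩ := hf.2.isWeakDeriv.exists_primitive_of_ae_eq hH'
  have hG := hasDerivAt_primitive hH d
  have hGc : Continuous fun x => d + ∫ t in (0 : ℝ)..x, (Q t : 𝕜) * F₀ t :=
    continuous_iff_continuousAt.mpr fun x => (hG x).continuousAt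
  obtain ⟨e, he⟩ := hf.1.isWeakDeriv.exists_primitive_of_ae_eq hd
  refine ⟨_, _, _, ⟨he, hasDerivAt_primitive hGc e, hG, hH, ?_, ?_⟩, hd, ?_⟩
  · exact (memLp_congr_ae hd).mp (Lp.memLp _)
  · exact (memLp_congr_ae hH').mp (Lp.memLp _)
  · filter_upwards [hc, he] with x h1 h2
    rw [← h2, h1]

end WeakDerivatives

/-! ### Jacobi's factorization of the quadratic form on one edge -/

section HalfLine

open Filter Topology
open scoped ComplexConjugate

variable {𝕜 : Type*} [RCLike 𝕜]

lemma integrable_conj_mul {u v : ℝ → 𝕜} (hu : MemLp u 2 halfLine) (hv : MemLp v 2 halfLine) :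
    Integrable (fun x => conj (u x) * v x) halfLine := by
  have h : MemLp (fun x => conj (u x)) 2 halfLine := hu.star
  exact h.integrable_mul hv

lemma hasDerivAt_conj_mul {u v : ℝ → 𝕜} {u' v' : 𝕜} {x : ℝ} (hu : HasDerivAt u u' x)
    (hv : HasDerivAt v v' x) :
    HasDerivAt (fun x => conj (u x) * v x) (conj u' * v x + conj (u x) * v') x :=
  ((RCLike.conjCLE (K := 𝕜)).toContinuousLinearMap.hasFDerivAt.comp_hasDerivAt x hu).mul hv

lemma hasDerivAt_re_conj_mul {u v : ℝ → 𝕜} {u' v' : 𝕜} {x : ℝ} (hu : HasDerivAt u u' x)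
    (hv : HasDerivAt v v' x) :
    HasDerivAt (fun x => RCLike.re (conj (u x) * v x))
      (RCLike.re (conj u' * v x) + RCLike.re (conj (u x) * v')) x := by
  have := (RCLike.reCLM (K := 𝕜)).hasFDerivAt.comp_hasDerivAt x (hasDerivAt_conj_mul hu hv)
  rw [← map_add]
  exact this

/-- The product and its derivative are both integrable, which forces the limit at infinity to exist
and vanish. This removes the boundary terms at infinity. -/
lemma tendsto_conj_mul_zero {u v u' v' : ℝ → 𝕜} (hu : ∀ x, HasDerivAt u (u' x) x)
    (hv : ∀ x, HasDerivAt v (v' x) x) (mu : MemLp u 2 halfLine) (mv : MemLp v 2 halfLine)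
    (mu' : MemLp u' 2 halfLine) (mv' : MemLp v' 2 halfLine) :
    Tendsto (fun x => conj (u x) * v x) atTop (𝓝 0) :=
  tendsto_zero_of_hasDerivAt_of_integrableOn_Ioi (a := 0)
    (fun x _ => hasDerivAt_conj_mul (hu x) (hv x))
    ((integrable_conj_mul mu' mv).add (integrable_conj_mul mu mv')) (integrable_conj_mul mu mv)

namespace IsC2Rep

variable {f f₁ f₂ : L2Half 𝕜} {F G H F₁ G₁ H₁ F₂ G₂ H₂ : ℝ → 𝕜}

lemma memLp (h : IsC2Rep f F G H) : MemLp F 2 halfLine :=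
  (memLp_congr_ae h.ae_eq).mp (Lp.memLp f)

lemma add (h₁ : IsC2Rep f₁ F₁ G₁ H₁) (h₂ : IsC2Rep f₂ F₂ G₂ H₂) :
    IsC2Rep (f₁ + f₂) (F₁ + F₂) (G₁ + G₂) (H₁ + H₂) where
  ae_eq := (Lp.coeFn_add f₁ f₂).trans (h₁.ae_eq.add h₂.ae_eq)
  hasDerivAt x := (h₁.hasDerivAt x).add (h₂.hasDerivAt x)
  hasDerivAt' x := (h₁.hasDerivAt' x).add (h₂.hasDerivAt' x)
  continuous := h₁.continuous.add h₂.continuous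
  memLp' := h₁.memLp'.add h₂.memLp'
  memLp'' := h₁.memLp''.add h₂.memLp''

lemma zero : IsC2Rep (0 : L2Half 𝕜) 0 0 0 where
  ae_eq := Lp.coeFn_zero 𝕜 2 halfLine
  hasDerivAt x := hasDerivAt_const x 0
  hasDerivAt' x := hasDerivAt_const x 0
  continuous := continuous_const
  memLp' := MemLp.zero
  memLp'' := MemLp.zero

lemma continuous_rep (h : IsC2Rep f F G H) : Continuous F :=
  continuous_iff_continuousAt.mpr fun x => (h.hasDerivAt x).continuousAt

lemma continuous_deriv (h : IsC2Rep f F G H) : Continuous G :=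
  continuous_iff_continuousAt.mpr fun x => (h.hasDerivAt' x).continuousAt

/-- Green's identity on the half-line. -/
lemma integral_green (h₁ : IsC2Rep f₁ F₁ G₁ H₁) (h₂ : IsC2Rep f₂ F₂ G₂ H₂) :
    ∫ x in Ioi (0 : ℝ), (conj (F₁ x) * H₂ x - conj (H₁ x) * F₂ x)
      = -(conj (F₁ 0) * G₂ 0 - conj (G₁ 0) * F₂ 0) := by
  have hd : ∀ x, HasDerivAt (fun x => conj (F₁ x) * G₂ x - conj (G₁ x) * F₂ x)
      (conj (F₁ x) * H₂ x - conj (H₁ x) * F₂ x) x := by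
    intro x
    refine ((hasDerivAt_conj_mul (h₁.hasDerivAt x) (h₂.hasDerivAt' x)).sub
      (hasDerivAt_conj_mul (h₁.hasDerivAt' x) (h₂.hasDerivAt x))).congr_deriv ?_
    ring
  have ht : Tendsto (fun x => conj (F₁ x) * G₂ x - conj (G₁ x) * F₂ x) atTop (𝓝 (0 - 0)) :=
    (tendsto_conj_mul_zero h₁.hasDerivAt h₂.hasDerivAt' h₁.memLp h₂.memLp' h₁.memLp'
      h₂.memLp'').sub
    (tendsto_conj_mul_zero h₁.hasDerivAt' h₂.hasDerivAt h₁.memLp' h₂.memLp h₁.memLp''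
      h₂.memLp')
  rw [integral_Ioi_of_hasDerivAt_of_tendsto' (fun x _ => hd x)
    ((integrable_conj_mul h₁.memLp h₂.memLp'').sub (integrable_conj_mul h₁.memLp'' h₂.memLp)) ht]
  simp

end IsC2Rep

/-- The Pöschl–Teller potential `σ² - (2β² + 3βσ + σ²) sech² (βx + s)`. -/
def poschlTeller (β σ s x : ℝ) : ℝ :=
  σ ^ 2 - (2 * β ^ 2 + 3 * β * σ + σ ^ 2) / Real.cosh (β * x + s) ^ 2

/-- The logarithmic derivative of a solution of `ψ'' = q ψ`, `q` the Pöschl–Teller potential. -/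
def riccati (β σ s x : ℝ) : ℝ :=
  β / (Real.sinh (β * x + s) * Real.cosh (β * x + s))
    - σ * (Real.sinh (β * x + s) / Real.cosh (β * x + s))

lemma continuous_poschlTeller (β σ s : ℝ) : Continuous (poschlTeller β σ s) := by
  unfold poschlTeller
  refine continuous_const.sub (continuous_const.div (by fun_prop) fun x => ?_)
  exact pow_ne_zero 2 (Real.cosh_pos _).ne'

lemma abs_poschlTeller_le (β σ s x : ℝ) :
    |poschlTeller β σ s x| ≤ σ ^ 2 + |2 * β ^ 2 + 3 * β * σ + σ ^ 2| := by
  unfold poschlTeller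
  refine (abs_sub _ _).trans ?_
  rw [abs_of_nonneg (sq_nonneg σ), abs_div, abs_of_nonneg (sq_nonneg (Real.cosh (β * x + s)))]
  gcongr
  exact div_le_self (abs_nonneg _) (one_le_pow₀ (Real.one_le_cosh _))

/-- Here `riccati` is ψ'/ψ for ψ = tanh y · (sech y)^(σ/β), y = βx + s, which solves ψ'' = qψ; the
Riccati equation follows. For the profile of the theorem ψ is a multiple of φ'. The only pole is at
y = 0. -/
lemma hasDerivAt_riccati (β σ s x : ℝ) (hx : Real.sinh (β * x + s) ≠ 0) :
    HasDerivAt (riccati β σ s) (poschlTeller β σ s x - riccati β σ s x ^ 2) x := by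
  have hy : HasDerivAt (fun x => β * x + s) β x := by
    simpa using ((hasDerivAt_id x).const_mul β).add_const s
  have hs := hy.sinh
  have hc := hy.cosh
  have hc0 := (Real.cosh_pos (β * x + s)).ne'
  have h := ((hasDerivAt_const x β).div (hs.mul hc) (mul_ne_zero hx hc0)).sub
    ((hs.div hc hc0).const_mul σ)
  refine h.congr_deriv ?_
  have e := Real.cosh_sq (β * x + s)
  unfold poschlTeller riccati
  simp only [Pi.mul_apply]
  set S := Real.sinh (β * x + s)
  set C := Real.cosh (β * x + s)
  field_simp
  have e2 : S ^ 2 = C ^ 2 - 1 := by rw [e]; ring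
  have e4 : S ^ 4 = (C ^ 2 - 1) ^ 2 := by rw [← e2]; ring
  ring_nf
  rw [e4, e2]
  ring

/-- The energy density primitive `Re(F̄ F') - r |F|²`. -/
def boundaryForm (r : ℝ → ℝ) (F G : ℝ → 𝕜) (x : ℝ) : ℝ :=
  RCLike.re (conj (F x) * G x) - r x * RCLike.re (conj (F x) * F x)

/-- Completing the square: inserting r' = q - r² turns |F'|² - 2r Re(F̄F') + r²|F|² into |F' - rF|².
-/
lemma hasDerivAt_boundaryForm {r : ℝ → ℝ} {F G H : ℝ → 𝕜} {q x : ℝ}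
    (hF : HasDerivAt F (G x) x) (hG : HasDerivAt G (H x) x)
    (hr : HasDerivAt r (q - r x ^ 2) x) :
    HasDerivAt (boundaryForm r F G)
      (‖G x - (r x : 𝕜) * F x‖ ^ 2 - RCLike.re (conj (F x) * (-H x + (q : 𝕜) * F x))) x := by
  refine ((hasDerivAt_re_conj_mul hF hG).sub
    (hr.mul (hasDerivAt_re_conj_mul hF hF))).congr_deriv ?_
  rw [← RCLike.normSq_eq_def', RCLike.normSq_apply]
  simp only [RCLike.mul_re, RCLike.mul_im, RCLike.conj_re, RCLike.conj_im, map_sub, map_add,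
    map_neg, RCLike.ofReal_re, RCLike.ofReal_im]
  ring

lemma re_conj_mul_self (z : 𝕜) : RCLike.re (conj z * z) = ‖z‖ ^ 2 := by
  rw [← RCLike.normSq_eq_def', RCLike.normSq_apply]
  simp [RCLike.mul_re]

lemma abs_le_abs_sinh (y : ℝ) : |y| ≤ |Real.sinh y| := by
  rw [Real.abs_sinh]
  exact Real.self_le_sinh_iff.mpr (abs_nonneg y)

/-- The pole of r is simple and F = O(x - x₀), so r|F|² is O(|F|) and tends to 0. -/
lemma continuousAt_boundaryForm_of_eq_zero {β σ s x₀ : ℝ} {F G : ℝ → 𝕜} {F' : 𝕜} (hβ : 0 < β)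
    (hF : HasDerivAt F F' x₀) (hG : ContinuousAt G x₀) (h0 : F x₀ = 0)
    (hx : β * x₀ + s = 0) : ContinuousAt (boundaryForm (riccati β σ s) F G) x₀ := by
  have hFc := hF.continuousAt
  have hre : ContinuousAt (fun x => RCLike.re (conj (F x) * G x)) x₀ :=
    RCLike.continuous_re.continuousAt.comp
      ((RCLike.continuous_conj.continuousAt.comp hFc).mul hG)
  refine hre.sub ?_
  -- The value assigned to r at its pole is irrelevant, since F vanishes there.
  have hval : riccati β σ s x₀ * RCLike.re (conj (F x₀) * F x₀) = 0 := by simp [h0]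
  rw [ContinuousAt, hval]
  obtain ⟨C, hC⟩ := hF.isBigO_sub.bound
  have hlim : Tendsto (fun x => (C + |σ| * ‖F x‖) * ‖F x‖) (𝓝 x₀) (𝓝 0) := by
    have hn : Tendsto (fun x => ‖F x‖) (𝓝 x₀) (𝓝 0) := by
      simpa [h0] using hFc.norm.tendsto
    simpa using ((hn.const_mul |σ|).const_add C).mul hn
  refine squeeze_zero_norm' ?_ hlim
  filter_upwards [hC] with x hx'
  have hy : β * x + s = β * (x - x₀) := by linarith
  rw [h0, sub_zero, Real.norm_eq_abs] at hx'
  rw [re_conj_mul_self, norm_mul, Real.norm_eq_abs, norm_pow, norm_norm]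
  set S := Real.sinh (β * x + s) with hS
  set c := Real.cosh (β * x + s) with hc
  have hc1 : 1 ≤ c := Real.one_le_cosh _
  have hSc : |S| ≤ c := by
    rw [hS, Real.abs_sinh, hc, ← Real.cosh_abs]
    exact (Real.sinh_lt_cosh _).le
  have hbS : β * |x - x₀| ≤ |S| := by
    have := abs_le_abs_sinh (β * x + s)
    rwa [hy, abs_mul, abs_of_pos hβ, ← hy] at this
  have h1 : |β / (S * c)| * ‖F x‖ ≤ C := by
    -- At the pole the claim is only 0 ≤ C, which is read off from the bound at some nearby point.
    rcases eq_or_ne x x₀ with rfl | hne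
    · rw [h0, norm_zero, mul_zero]
      by_contra hC'
      push Not at hC'
      obtain ⟨z, hz, hz'⟩ : ∃ z, ‖F z - F x‖ ≤ C * ‖z - x‖ ∧ z ≠ x :=
        ((hC.filter_mono nhdsWithin_le_nhds).and
          (self_mem_nhdsWithin : {x}ᶜ ∈ 𝓝[≠] x)).exists
      have := norm_pos_iff.mpr (sub_ne_zero.mpr hz')
      have := norm_nonneg (F z - F x)
      nlinarith
    · have hpos : 0 < |x - x₀| := abs_pos.mpr (sub_ne_zero.mpr hne)
      have hSpos : 0 < |S| := (mul_pos hβ hpos).trans_le hbS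
      rw [abs_div, abs_mul, abs_of_pos hβ, abs_of_pos (by linarith : 0 < c), div_mul_eq_mul_div,
        div_le_iff₀ (by positivity)]
      have hC0 : 0 ≤ C := by
        by_contra hC'
        have := norm_nonneg (F x)
        nlinarith
      calc β * ‖F x‖ ≤ β * (C * |x - x₀|) := by gcongr
        _ = C * (β * |x - x₀|) := by ring
        _ ≤ C * |S| := by gcongr
        _ ≤ C * (|S| * c) := by
          gcongr
          exact le_mul_of_one_le_right hSpos.le hc1
  have h2 : |σ * (S / c)| ≤ |σ| := by
    rw [abs_mul, abs_div, abs_of_pos (by linarith : 0 < c)]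
    exact mul_le_of_le_one_right (abs_nonneg _) (div_le_one_of_le₀ hSc (by linarith))
  have h3 : |riccati β σ s x| ≤ |β / (S * c)| + |σ * (S / c)| := abs_sub _ _
  calc |riccati β σ s x| * ‖F x‖ ^ 2
      ≤ (|β / (S * c)| + |σ|) * ‖F x‖ ^ 2 := by gcongr; exact h3.trans (by gcongr)
    _ = (|β / (S * c)| * ‖F x‖ + |σ| * ‖F x‖) * ‖F x‖ := by ring
    _ ≤ (C + |σ| * ‖F x‖) * ‖F x‖ := by gcongr

/-- Boundedness of r far out is what makes r|F|² vanish at infinity. -/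
lemma eventually_abs_riccati_le {β : ℝ} (hβ : 0 < β) (σ s : ℝ) :
    ∀ᶠ x in atTop, |riccati β σ s x| ≤ β + |σ| := by
  filter_upwards [eventually_ge_atTop ((1 - s) / β)] with x hx
  have hy : 1 ≤ β * x + s := by
    rw [div_le_iff₀ hβ] at hx
    linarith
  have hS : 1 ≤ Real.sinh (β * x + s) := hy.trans (Real.self_le_sinh_iff.mpr (by linarith))
  have hc := Real.one_le_cosh (β * x + s)
  have hSc := (Real.sinh_lt_cosh (β * x + s)).le
  refine (abs_sub _ _).trans ?_
  have hS0 : 0 ≤ Real.sinh (β * x + s) := by linarith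
  have hc0 : 0 ≤ Real.cosh (β * x + s) := by linarith
  rw [abs_mul, abs_of_nonneg (div_nonneg hβ.le (mul_nonneg hS0 hc0)),
    abs_of_nonneg (div_nonneg hS0 hc0)]
  refine add_le_add (div_le_self hβ.le (one_le_mul_of_one_le_of_one_le hS hc)) ?_
  exact mul_le_of_le_one_right (abs_nonneg _) (div_le_one_of_le₀ hSc (by linarith))

/-- Jacobi's form of the quadratic form on a half-line: if `F` vanishes at the singularity of the
logarithmic derivative `r`, then `∫ Re (F̄ (-F'' + q F)) ≥ Re (F̄ F')(0) - r(0) |F(0)|²`. -/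
lemma IsC2Rep.boundaryForm_le_integral {f : L2Half 𝕜} {F G H : ℝ → 𝕜} (h : IsC2Rep f F G H)
    {β σ s : ℝ} (hβ : 0 < β) (hs : s ≠ 0) (h0 : s < 0 → F (-s / β) = 0) :
    boundaryForm (riccati β σ s) F G 0 ≤
      ∫ x in Ioi (0 : ℝ),
        RCLike.re (conj (F x) * (-H x + (poschlTeller β σ s x : 𝕜) * F x)) := by
  set q := poschlTeller β σ s with hq
  set e : ℝ → ℝ := fun x => RCLike.re (conj (F x) * (-H x + (q x : 𝕜) * F x)) with he
  have hqc : Continuous q := continuous_poschlTeller β σ s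
  have hec : Continuous e := RCLike.continuous_re.comp
    ((RCLike.continuous_conj.comp h.continuous_rep).mul
      (h.continuous.neg.add ((RCLike.continuous_ofReal.comp hqc).mul h.continuous_rep)))
  have hqF : MemLp (fun x => (q x : 𝕜) * F x) 2 halfLine := by
    refine h.memLp.of_le_mul (c := σ ^ 2 + |2 * β ^ 2 + 3 * β * σ + σ ^ 2|)
      ((RCLike.continuous_ofReal.comp hqc).mul h.continuous_rep).aestronglyMeasurable
      (ae_of_all _ fun x => ?_)
    rw [norm_mul, RCLike.norm_ofReal]
    exact mul_le_mul_of_nonneg_right (abs_poschlTeller_le _ _ _ _) (norm_nonneg _)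
  have hei : IntegrableOn e (Ioi 0) :=
    (integrable_conj_mul h.memLp (h.memLp''.neg.add hqF)).re
  -- By the square identity K' = |F' - rF|² ≥ 0 off the pole. K starts at the boundary form at 0 and
  -- tends to the full integral, so monotonicity is the claim.
  set K : ℝ → ℝ := fun x => (∫ t in (0 : ℝ)..x, e t) + boundaryForm (riccati β σ s) F G x with hK
  have hKd : ∀ x, β * x + s ≠ 0 →
      HasDerivAt K (‖G x - (riccati β σ s x : 𝕜) * F x‖ ^ 2) x := by
    intro x hx
    have h1 := intervalIntegral.integral_hasDerivAt_right (hec.intervalIntegrable 0 x)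
      (hec.stronglyMeasurableAtFilter _ _) hec.continuousAt
    refine (h1.add (hasDerivAt_boundaryForm (h.hasDerivAt x) (h.hasDerivAt' x)
      (hasDerivAt_riccati β σ s x (by rwa [Ne, Real.sinh_eq_zero])))).congr_deriv ?_
    simp only [he, hq]
    ring
  have hKc : ∀ x, β * x + s ≠ 0 ∨ F x = 0 → ContinuousAt K x := by
    intro x hx
    by_cases hx0 : β * x + s = 0
    · have hFx : F x = 0 := hx.resolve_left fun h => h hx0
      exact (intervalIntegral.continuous_primitive (fun a b => hec.intervalIntegrable a b)
        0).continuousAt.add (continuousAt_boundaryForm_of_eq_zero hβ (h.hasDerivAt x)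
          h.continuous_deriv.continuousAt hFx hx0)
    · exact (hKd x hx0).continuousAt
  have hmono : ∀ D : Set ℝ, Convex ℝ D → (∀ x ∈ D, β * x + s ≠ 0 ∨ F x = 0) →
      (∀ x ∈ interior D, β * x + s ≠ 0) → MonotoneOn K D := by
    intro D hD h1 h2
    refine monotoneOn_of_deriv_nonneg hD (fun x hx => (hKc x (h1 x hx)).continuousWithinAt)
      (fun x hx => (hKd x (h2 x hx)).differentiableAt.differentiableWithinAt) fun x hx => ?_
    rw [(hKd x (h2 x hx)).deriv]
    positivity
  -- For s < 0 the pole -s/β lies inside the edge: K is monotone on either side of it, and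
  -- continuity there glues the two pieces. For s > 0 there is no pole on [0, ∞).
  have hle : ∀ᶠ x in atTop, K 0 ≤ K x := by
    rcases lt_or_gt_of_ne hs with hs | hs
    · have hx0 : 0 < -s / β := div_pos (neg_pos.mpr hs) hβ
      have hy : ∀ x, β * x + s = 0 → x = -s / β := by
        intro x hx
        rw [eq_div_iff hβ.ne']
        linarith
      have hor : ∀ x, β * x + s ≠ 0 ∨ F x = 0 := by
        intro x
        by_cases hx : β * x + s = 0
        · exact Or.inr (by rw [hy x hx]; exact h0 hs)
        · exact Or.inl hx
      have m1 := hmono (Icc 0 (-s / β)) (convex_Icc _ _) (fun x _ => hor x) (by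
        rw [interior_Icc]
        exact fun x hx hx' => hx.2.ne (hy x hx'))
      have m2 := hmono (Ici (-s / β)) (convex_Ici _) (fun x _ => hor x) (by
        rw [interior_Ici]
        exact fun x hx hx' => (ne_of_gt hx) (hy x hx'))
      filter_upwards [eventually_ge_atTop (-s / β)] with x hx
      exact (m1 ⟨le_rfl, hx0.le⟩ ⟨hx0.le, le_rfl⟩ hx0.le).trans
        (m2 self_mem_Ici hx hx)
    · have hy : ∀ x, 0 ≤ x → β * x + s ≠ 0 := fun x hx => by positivity
      have m := hmono (Ici 0) (convex_Ici _) (fun x hx => Or.inl (hy x hx)) (by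
        rw [interior_Ici]
        exact fun x hx => hy x (le_of_lt hx))
      filter_upwards [eventually_ge_atTop 0] with x hx
      exact m self_mem_Ici hx hx
  have hlim : Tendsto K atTop (𝓝 ((∫ x in Ioi (0 : ℝ), e x) + (0 - 0))) := by
    refine (intervalIntegral_tendsto_integral_Ioi 0 hei tendsto_id).add (Tendsto.sub ?_ ?_)
    · have := (RCLike.continuous_re.tendsto (0 : 𝕜)).comp (tendsto_conj_mul_zero h.hasDerivAt
        h.hasDerivAt' h.memLp h.memLp' h.memLp' h.memLp'')
      rwa [map_zero] at this
    · have h1 := (RCLike.continuous_re.tendsto (0 : 𝕜)).comp (tendsto_conj_mul_zero h.hasDerivAt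
        h.hasDerivAt h.memLp h.memLp h.memLp' h.memLp')
      rw [map_zero] at h1
      have h2 := (h1.abs.const_mul (β + |σ|))
      rw [abs_zero, mul_zero] at h2
      refine squeeze_zero_norm' ?_ h2
      filter_upwards [eventually_abs_riccati_le hβ σ s] with x hx
      rw [norm_mul]
      exact mul_le_mul_of_nonneg_right hx (abs_nonneg _)
  have hfin := ge_of_tendsto hlim hle
  simpa [hK] using hfin

end HalfLine

/-! ### Abstract bound of the Morse index by a number of linear conditions -/

section MorseIndexBound

open scoped InnerProductSpace

variable {𝕜 E : Type*} [RCLike 𝕜] [NormedAddCommGroup E] [InnerProductSpace 𝕜 E]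

/-- If the eigenspaces of `A` are mutually orthogonal and the quadratic form of `A` is nonnegative
on those sums of eigenvectors that are annihilated by the functionals `T i`, `i : ι`, then
the Morse index of `A` is at most the number of these functionals. -/
theorem morseIndex_le_card {ι : Type} [Fintype ι] (A : E →ₗ.[𝕜] E)
    (horth : ∀ l m : ℝ, l ≠ m → ∀ v ∈ eigenspace A l, ∀ w ∈ eigenspace A m, ⟪v, w⟫_𝕜 = 0)
    (S : Submodule 𝕜 E) (hS : ∀ l : ℝ, eigenspace A l ≤ S) (T : S →ₗ[𝕜] (ι → 𝕜))
    (hpos : ∀ (s : Finset (Iio (0 : ℝ))) (v : ∀ l : s, eigenspace A ((l : Iio (0 : ℝ)) : ℝ)),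
      T (∑ l : s, ⟨v l, hS _ (v l).2⟩) = 0 →
        0 ≤ RCLike.re ⟪∑ l : s, (v l : E),
          ∑ l : s, (((l : Iio (0 : ℝ)) : ℝ) : 𝕜) • (v l : E)⟫_𝕜) :
    morseIndex A ≤ Fintype.card ι := by
  refine iSup_le fun s => ?_
  -- A family in the kernel of Φ sums to a vector of nonnegative energy. By orthogonality this
  -- energy is ∑ l ‖v l‖² with every l < 0, so each component vanishes.
  let Φ : (∀ l : s, eigenspace A ((l : Iio (0 : ℝ)) : ℝ)) →ₗ[𝕜] (ι → 𝕜) :=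
    T ∘ₗ ∑ l : s, Submodule.inclusion (hS _) ∘ₗ LinearMap.proj l
  have hinj : Function.Injective Φ := by
    rw [← LinearMap.ker_eq_bot, LinearMap.ker_eq_bot']
    intro v hv
    have h0 : T (∑ l : s, ⟨v l, hS _ (v l).2⟩) = 0 := by
      simp only [Φ, LinearMap.comp_apply, LinearMap.sum_apply, LinearMap.proj_apply] at hv
      exact hv
    have h1 := hpos s v h0
    have h2 : ⟪∑ l : s, (v l : E), ∑ l : s, (((l : Iio (0 : ℝ)) : ℝ) : 𝕜) • (v l : E)⟫_𝕜
        = ∑ l : s, (((l : Iio (0 : ℝ)) : ℝ) : 𝕜) * ⟪(v l : E), (v l : E)⟫_𝕜 := by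
      rw [sum_inner]
      refine Finset.sum_congr rfl fun l _ => ?_
      rw [inner_sum, Finset.sum_eq_single l]
      · rw [inner_smul_right]
      · intro m _ hm
        rw [inner_smul_right, horth _ _ (fun h => hm (Subtype.ext (Subtype.ext h.symm))) _
          (v l).2 _ (v m).2, mul_zero]
      · simp
    have h3 : ∀ l : s, ((l : Iio (0 : ℝ)) : ℝ) * ‖(v l : E)‖ ^ 2 ≤ 0 := fun l =>
      mul_nonpos_of_nonpos_of_nonneg (le_of_lt (l : Iio (0 : ℝ)).2) (sq_nonneg _)
    have h4 : ∑ l : s, ((l : Iio (0 : ℝ)) : ℝ) * ‖(v l : E)‖ ^ 2 = 0 := by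
      refine le_antisymm (Finset.sum_nonpos fun l _ => h3 l) ?_
      rw [h2, map_sum] at h1
      refine h1.trans_eq (Finset.sum_congr rfl fun l _ => ?_)
      rw [RCLike.re_ofReal_mul, inner_self_eq_norm_sq]
    funext l
    have h5 := (Finset.sum_eq_zero_iff_of_nonpos fun l _ => h3 l).mp h4 l (Finset.mem_univ l)
    rcases mul_eq_zero.mp h5 with h6 | h6
    · exact absurd h6 (l : Iio (0 : ℝ)).2.ne
    · exact Subtype.ext (norm_eq_zero.mp (pow_eq_zero_iff two_ne_zero |>.mp h6))
  -- Eigenspaces are not known in advance to be finite-dimensional; injectivity of Φ gives this, and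
  -- ranks can be replaced by `finrank`.
  have hfin : ∀ l : s, Module.Finite 𝕜 (eigenspace A ((l : Iio (0 : ℝ)) : ℝ)) := fun l =>
    Module.Finite.of_injective 
      (Φ ∘ₗ LinearMap.single 𝕜 (fun l : s => eigenspace A ((l : Iio (0 : ℝ)) : ℝ)) l)
      (hinj.comp fun _ _ h => Pi.single_injective l h)
  have hle := LinearMap.finrank_le_finrank_of_injective hinj
  rw [Module.finrank_pi_fintype, Module.finrank_pi] at hle
  rw [← Finset.sum_coe_sort s]
  have e : ∀ l : s, Cardinal.toENat (Module.rank 𝕜 (eigenspace A ((l : Iio (0 : ℝ)) : ℝ)))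
      = (Module.finrank 𝕜 (eigenspace A ((l : Iio (0 : ℝ)) : ℝ)) : ℕ∞) := fun l => by
    rw [← Module.finrank_eq_rank, Cardinal.toENat_nat]
  rw [Finset.sum_congr rfl fun l _ => e l, ← Nat.cast_sum]
  exact_mod_cast hle

end MorseIndexBound

/-! ### Point evaluation of continuous representatives -/

section Evaluation

variable {𝕜 : Type*} [RCLike 𝕜]

lemma eqOn_of_ae_eq_halfLine {F G : ℝ → 𝕜} (hF : ContinuousOn F (Ici 0))
    (hG : ContinuousOn G (Ici 0)) (h : F =ᵐ[halfLine] G) : EqOn F G (Ici 0) := by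
  have h' : F =ᵐ[volume.restrict (Ici 0)] G := by
    rwa [← restrict_Ioi_eq_restrict_Ici]
  exact Measure.eqOn_of_ae_eq h' hF hG (by rw [interior_Ici, closure_Ioi])

/-- Transfers the vertex conditions of the domain to the classical representatives. -/
lemma HasValueAtVertex.eq_of_ae_eq {f : L2Half 𝕜} {c : 𝕜} (h : HasValueAtVertex f c)
    {F : ℝ → 𝕜} (hF : Continuous F) (hf : f =ᵐ[halfLine] F) : c = F 0 := by
  obtain ⟨F', hF', hf', rfl⟩ := h
  exact eqOn_of_ae_eq_halfLine hF' hF.continuousOn (hf'.symm.trans hf) self_mem_Ici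

variable (𝕜) in
/-- The elements of `L²(ℝ₊)` that have a representative continuous on `[0, ∞)`. -/
def continuousReps : Submodule 𝕜 (L2Half 𝕜) where
  carrier := {f | ∃ F : ℝ → 𝕜, ContinuousOn F (Ici 0) ∧ f =ᵐ[halfLine] F}
  zero_mem' := ⟨0, continuousOn_const, Lp.coeFn_zero 𝕜 2 halfLine⟩
  add_mem' := by
    rintro f g ⟨F, hF, hfF⟩ ⟨G, hG, hgG⟩
    exact ⟨F + G, hF.add hG, (Lp.coeFn_add f g).trans (hfF.add hgG)⟩
  smul_mem' := by
    rintro a f ⟨F, hF, hfF⟩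
    exact ⟨a • F, hF.const_smul a, (Lp.coeFn_smul a f).trans (hfF.const_smul a)⟩

/-- Continuous representatives are unique on [0, ∞), so evaluation through a chosen one is well
defined and linear. -/
lemma choose_continuousReps_eq (f : continuousReps 𝕜) {F : ℝ → 𝕜} (hF : ContinuousOn F (Ici 0))
    (hf : (f : L2Half 𝕜) =ᵐ[halfLine] F) {x : ℝ} (hx : 0 ≤ x) : f.2.choose x = F x :=
  eqOn_of_ae_eq_halfLine f.2.choose_spec.1 hF (f.2.choose_spec.2.symm.trans hf) hx

/-- The value of the continuous representative at a point of `[0, ∞)`. -/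
def evalAt (x : ℝ) (hx : 0 ≤ x) : continuousReps 𝕜 →ₗ[𝕜] 𝕜 where
  toFun f := f.2.choose x
  map_add' f g := choose_continuousReps_eq (f + g)
    (f.2.choose_spec.1.add g.2.choose_spec.1)
    ((Lp.coeFn_add _ _).trans (f.2.choose_spec.2.add g.2.choose_spec.2)) hx
  map_smul' a f := choose_continuousReps_eq (a • f) (f.2.choose_spec.1.const_smul a)
    ((Lp.coeFn_smul _ _).trans (f.2.choose_spec.2.const_smul a)) hx

lemma evalAt_eq {x : ℝ} (hx : 0 ≤ x) (f : continuousReps 𝕜) {F : ℝ → 𝕜} (hF : Continuous F)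
    (hf : (f : L2Half 𝕜) =ᵐ[halfLine] F) : evalAt x hx f = F x :=
  choose_continuousReps_eq f hF.continuousOn hf hx

variable (𝕜) in
/-- The elements of `L²(𝒢)` that have a representative continuous on every closed edge. -/
def continuousRepsStar (N : ℕ) : Submodule 𝕜 (L2Star 𝕜 N) where
  carrier := {V | ∀ j, V j ∈ continuousReps 𝕜}
  zero_mem' _ := (continuousReps 𝕜).zero_mem
  add_mem' hV hW j := (continuousReps 𝕜).add_mem (hV j) (hW j)
  smul_mem' a _ hV j := (continuousReps 𝕜).smul_mem a (hV j)

/-- The component on the edge `j`. -/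
def edgeComponent {N : ℕ} (j : Fin N) : continuousRepsStar 𝕜 N →ₗ[𝕜] continuousReps 𝕜 where
  toFun V := ⟨(V : L2Star 𝕜 N) j, V.2 j⟩
  map_add' _ _ := rfl
  map_smul' _ _ := rfl

end Evaluation

/-! ### Eigenvectors on the star graph: symmetry, lower bound, counting -/

section Graph

open scoped InnerProductSpace ComplexConjugate

variable {𝕜 : Type*} [RCLike 𝕜] {N : ℕ} {α : ℝ} {q : Fin N → ℝ → ℝ}

/-- `V` is a classical (twice continuously differentiable) element of the domain of the
Schrödinger operator with potential `q`, and `W` is its image. -/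
def IsClassicalPair (α : ℝ) (q : Fin N → ℝ → ℝ) (V W : L2Star 𝕜 N) : Prop :=
  ∃ (F G H : Fin N → ℝ → 𝕜) (c : 𝕜), (∀ j, IsC2Rep (V j) (F j) (G j) (H j)) ∧
    (∀ j, W j =ᵐ[halfLine] fun x => -H j x + (q j x : 𝕜) * F j x) ∧
    (∀ j, F j 0 = c) ∧ ∑ j, G j 0 = (α : 𝕜) * c

lemma IsClassicalPair.zero : IsClassicalPair α q (0 : L2Star 𝕜 N) 0 := by
  refine ⟨0, 0, 0, 0, fun j => IsC2Rep.zero, fun j => ?_, fun j => rfl, by simp⟩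
  filter_upwards [Lp.coeFn_zero 𝕜 2 halfLine] with x hx
  simpa using hx

lemma IsClassicalPair.add {V V' W W' : L2Star 𝕜 N} (h : IsClassicalPair α q V W)
    (h' : IsClassicalPair α q V' W') : IsClassicalPair α q (V + V') (W + W') := by
  obtain ⟨F, G, H, c, hr, hW, hc, hG⟩ := h
  obtain ⟨F', G', H', c', hr', hW', hc', hG'⟩ := h'
  refine ⟨F + F', G + G', H + H', c + c', fun j => (hr j).add (hr' j), fun j => ?_,
    fun j => ?_, ?_⟩
  · filter_upwards [Lp.coeFn_add (W j) (W' j), hW j, hW' j] with x h1 h2 h3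
    change (W j + W' j : L2Half 𝕜) x = _
    rw [h1, Pi.add_apply, h2, h3]
    simp only [Pi.add_apply]
    ring
  · simp only [Pi.add_apply, hc, hc']
  · simp only [Pi.add_apply, Finset.sum_add_distrib, hG, hG', mul_add]

/-- The Morse index bound tests the form on sums of eigenvectors for different eigenvalues, which
are no longer eigenvectors but remain classical. -/
lemma IsClassicalPair.sum {ι : Type*} (s : Finset ι) {V W : ι → L2Star 𝕜 N}
    (h : ∀ i ∈ s, IsClassicalPair α q (V i) (W i)) :
    IsClassicalPair α q (∑ i ∈ s, V i) (∑ i ∈ s, W i) := by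
  classical
  induction s using Finset.induction_on with
  | empty => simpa using IsClassicalPair.zero
  | insert a s ha ih =>
    rw [Finset.sum_insert ha, Finset.sum_insert ha]
    exact (h a (Finset.mem_insert_self a s)).add
      (ih fun i hi => h i (Finset.mem_insert_of_mem hi))

/-- Eigenvectors are classical solutions. -/
lemma isClassicalPair_of_mem_eigenspace (hq : ∀ j, Continuous (q j)) {l : ℝ}
    {V : L2Star 𝕜 N} (hV : V ∈ eigenspace (schrodinger 𝕜 N α q) l) :
    IsClassicalPair α q V ((l : 𝕜) • V) := by
  obtain ⟨hd, hV⟩ := hV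
  obtain ⟨hH2, c, d, hc, hd', hs⟩ := hd.1
  have hw : ∀ j, weakDeriv (weakDeriv (V j)) =ᵐ[halfLine]
      fun x => ((q j x - l : ℝ) : 𝕜) * V j x := by
    intro j
    have e : -weakDeriv (weakDeriv (V j)) + (hd.2 j).toLp _ = (l : 𝕜) • V j :=
      congrArg (fun U : L2Star 𝕜 N => U j) hV
    have e' : weakDeriv (weakDeriv (V j)) = (hd.2 j).toLp _ - (l : 𝕜) • V j := by
      rw [← e]
      abel
    rw [e']
    filter_upwards [Lp.coeFn_sub ((hd.2 j).toLp _) ((l : 𝕜) • V j), (hd.2 j).coeFn_toLp,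
      Lp.coeFn_smul (l : 𝕜) (V j)] with x h1 h2 h3
    rw [h1, Pi.sub_apply, h2, h3, Pi.smul_apply, smul_eq_mul]
    push_cast
    ring
  choose F G H hr hG hH using fun j =>
    (hH2 j).exists_isC2Rep ((hq j).sub continuous_const) (hw j)
  refine ⟨F, G, H, c, hr, fun j => ?_, fun j => ?_, ?_⟩
  · filter_upwards [hH j, Lp.coeFn_smul (l : 𝕜) (V j), (hr j).ae_eq] with x h1 h2 h3
    change ((l : 𝕜) • V j : L2Half 𝕜) x = _
    rw [h2, Pi.smul_apply, smul_eq_mul, h1, h3, Pi.sub_apply]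
    push_cast
    ring
  · exact ((hc j).eq_of_ae_eq (hr j).continuous_rep (hr j).ae_eq).symm
  · rw [← hs]
    exact Finset.sum_congr rfl fun j _ =>
      ((hd' j).eq_of_ae_eq (hr j).continuous_deriv (hG j)).symm

lemma inner_eq_sum_integral (V W : L2Star 𝕜 N) :
    ⟪V, W⟫_𝕜 = ∑ j, ∫ x in Ioi (0 : ℝ), conj (V j x) * W j x := by
  rw [PiLp.inner_apply]
  refine Finset.sum_congr rfl fun j _ => ?_
  rw [L2.inner_def]
  refine integral_congr_ae (ae_of_all _ fun x => ?_)
  simp only [RCLike.inner_apply, mul_comm]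

lemma integrable_conj_mul_coeFn (f g : L2Half 𝕜) :
    Integrable (fun x => conj (f x) * g x) halfLine :=
  integrable_conj_mul (Lp.memLp f) (Lp.memLp g)

/-- The Schrödinger operator is symmetric on classical elements. -/
lemma IsClassicalPair.inner_eq {V W V' W' : L2Star 𝕜 N} (h : IsClassicalPair α q V W)
    (h' : IsClassicalPair α q V' W') : ⟪V, W'⟫_𝕜 = ⟪W, V'⟫_𝕜 := by
  obtain ⟨F, G, H, c, hr, hW, hc, hG⟩ := h
  obtain ⟨F', G', H', c', hr', hW', hc', hG'⟩ := h'
  rw [← sub_eq_zero, inner_eq_sum_integral, inner_eq_sum_integral, ← Finset.sum_sub_distrib]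
  have e : ∀ j, (∫ x in Ioi (0 : ℝ), conj (V j x) * W' j x)
      - (∫ x in Ioi (0 : ℝ), conj (W j x) * V' j x)
      = conj (F j 0) * G' j 0 - conj (G j 0) * F' j 0 := by
    intro j
    rw [← integral_sub (integrable_conj_mul_coeFn _ _) (integrable_conj_mul_coeFn _ _),
      ← neg_neg (conj (F j 0) * G' j 0 - conj (G j 0) * F' j 0),
      ← (hr j).integral_green (hr' j), ← integral_neg]
    refine integral_congr_ae ?_
    filter_upwards [(hr j).ae_eq, (hr' j).ae_eq, hW j, hW' j] with x h1 h2 h3 h4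
    rw [h1, h2, h3, h4]
    simp only [map_add, map_mul, map_neg, RCLike.conj_ofReal]
    ring
  rw [Finset.sum_congr rfl fun j _ => e j, Finset.sum_sub_distrib]
  -- The vertex conditions turn the boundary terms into c̄ · αc' and the conjugate of αc times c',
  -- which cancel because α is real.
  simp only [hc, hc']
  rw [← Finset.mul_sum, ← Finset.sum_mul, ← map_sum, hG, hG', map_mul, RCLike.conj_ofReal]
  ring

lemma inner_eq_zero_of_mem_eigenspace (hq : ∀ j, Continuous (q j)) {l m : ℝ}
    (hlm : l ≠ m) {V W : L2Star 𝕜 N} (hV : V ∈ eigenspace (schrodinger 𝕜 N α q) l)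
    (hW : W ∈ eigenspace (schrodinger 𝕜 N α q) m) : ⟪V, W⟫_𝕜 = 0 := by
  have h := (isClassicalPair_of_mem_eigenspace hq hV).inner_eq
    (isClassicalPair_of_mem_eigenspace hq hW)
  rw [inner_smul_left, inner_smul_right, RCLike.conj_ofReal, ← sub_eq_zero, ← sub_mul] at h
  rcases mul_eq_zero.mp h with h | h
  · exact absurd (RCLike.ofReal_injective (sub_eq_zero.mp h)).symm hlm
  · exact h

/-- Lower bound for the quadratic form of a Schrödinger operator with Pöschl–Teller potentials. -/
lemma IsClassicalPair.re_inner_nonneg {β σ : ℝ} (hβ : 0 < β) {s : Fin N → ℝ}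
    (hs : ∀ j, s j ≠ 0) {V W : L2Star 𝕜 N}
    (h : IsClassicalPair α (fun j => poschlTeller β σ (s j)) V W)
    (h0 : ∀ j, s j < 0 → ∀ F : ℝ → 𝕜, Continuous F → V j =ᵐ[halfLine] F → F (-s j / β) = 0)
    (h1 : ∑ j, riccati β σ (s j) 0 ≤ α ∨
      ∃ j, ∀ F : ℝ → 𝕜, Continuous F → V j =ᵐ[halfLine] F → F 0 = 0) :
    0 ≤ RCLike.re ⟪V, W⟫_𝕜 := by
  obtain ⟨F, G, H, c, hr, hW, hc, hG⟩ := h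
  have e : ∀ j, RCLike.re (∫ x in Ioi (0 : ℝ), conj (V j x) * W j x)
      = ∫ x in Ioi (0 : ℝ), RCLike.re (conj (F j x) *
        (-H j x + (poschlTeller β σ (s j) x : 𝕜) * F j x)) := by
    intro j
    rw [← integral_re (integrable_conj_mul_coeFn _ _)]
    refine integral_congr_ae ?_
    filter_upwards [(hr j).ae_eq, hW j] with x h1 h2
    rw [h1, h2]
  rw [inner_eq_sum_integral, map_sum, Finset.sum_congr rfl fun j _ => e j]
  refine le_trans ?_ (Finset.sum_le_sum fun j _ => (hr j).boundaryForm_le_integral hβ (hs j)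
    fun hj => h0 j hj _ (hr j).continuous_rep (hr j).ae_eq)
  -- Continuity at the vertex and ∑ F_j'(0) = αc reduce all boundary terms to a multiple of |c|²;
  -- either the factor is nonnegative or c = 0.
  have e2 : ∑ j, boundaryForm (riccati β σ (s j)) (F j) (G j) 0
      = (α - ∑ j, riccati β σ (s j) 0) * ‖c‖ ^ 2 := by
    simp only [boundaryForm, hc, re_conj_mul_self, Finset.sum_sub_distrib]
    rw [← Finset.sum_mul, ← map_sum, ← Finset.mul_sum, hG, mul_left_comm, RCLike.re_ofReal_mul,
      re_conj_mul_self]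
    ring
  rw [e2]
  rcases h1 with h1 | ⟨j, hj⟩
  · exact mul_nonneg (sub_nonneg.mpr h1) (sq_nonneg _)
  · rw [← hc j, hj _ (hr j).continuous_rep (hr j).ae_eq]
    simp

/-- If the quadratic form is nonnegative on classical elements that vanish at the points `x i` of
the edges `j i`, `i : ι`, then the Morse index is at most the number of these points. -/
theorem morseIndex_schrodinger_le_card {ι : Type} [Fintype ι] (hq : ∀ j, Continuous (q j))
    (j : ι → Fin N) (x : ι → ℝ) (hx : ∀ i, 0 ≤ x i)
    (hpos : ∀ V W : L2Star 𝕜 N, IsClassicalPair α q V W →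
      (∀ i, ∀ F : ℝ → 𝕜, Continuous F → V (j i) =ᵐ[halfLine] F → F (x i) = 0) →
        0 ≤ RCLike.re ⟪V, W⟫_𝕜) :
    morseIndex (schrodinger 𝕜 N α q) ≤ Fintype.card ι := by
  have hcl : ∀ l : ℝ, ∀ V ∈ eigenspace (schrodinger 𝕜 N α q) l,
      IsClassicalPair α q V ((l : 𝕜) • V) := fun l V hV =>
    isClassicalPair_of_mem_eigenspace hq hV
  refine morseIndex_le_card (schrodinger 𝕜 N α q)
    (fun l m hlm v hv w hw => inner_eq_zero_of_mem_eigenspace hq hlm hv hw)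
    (continuousRepsStar 𝕜 N) (fun l V hV i => ?_)
    (LinearMap.pi fun i => evalAt (x i) (hx i) ∘ₗ edgeComponent (j i)) fun s v hv => ?_
  · obtain ⟨F, G, H, c, hr, -⟩ := hcl l V hV
    exact ⟨F i, (hr i).continuous_rep.continuousOn, (hr i).ae_eq⟩
  · refine hpos _ _ (IsClassicalPair.sum _ fun l _ => hcl _ _ (v l).2) fun i F hF hVF => ?_
    have h := congrFun hv i
    rw [LinearMap.pi_apply, LinearMap.comp_apply, evalAt_eq (hx i) _ hF ?_] at h
    · exact h
    · change ((∑ l : s, (⟨v l, _⟩ : continuousRepsStar 𝕜 N) : continuousRepsStar 𝕜 N) :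
        L2Star 𝕜 N) (j i) =ᵐ[halfLine] F
      rwa [Submodule.coe_sum]

end Graph

/-! ### The potentials of the theorem and the signs at the vertex -/

section Profile

/-- The argument of the profile at the vertex of the edge `j`. -/
def edgeShift (N k : ℕ) (α ω : ℝ) (j : Fin N) : ℝ :=
  if (j : ℕ) < k then -shift N k α ω else shift N k α ω

/-- The coefficient factors as (2β + σ)(β + σ); for β = (p-1)√ω/2 and σ = √ω the factors are p√ω and
(p+1)√ω/2, with product p(p+1)ω/2. -/
lemma potential_eq_poschlTeller {N k : ℕ} {p α ω : ℝ} (hp : 1 < p) (hω : 0 < ω) :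
    potential N k p α ω
      = fun j => poschlTeller ((p - 1) * √ω / 2) √ω (edgeShift N k α ω j) := by
  funext j x
  have h0 : 0 < p - 1 := by linarith
  rw [potential, profile, ← Real.rpow_mul (by positivity), one_div_mul_cancel h0.ne',
    Real.rpow_one, poschlTeller, edgeShift]
  have h1 : √ω ^ 2 = ω := Real.sq_sqrt hω.le
  have h2 : 2 * ((p - 1) * √ω / 2) ^ 2 + 3 * ((p - 1) * √ω / 2) * √ω + √ω ^ 2
      = p * ((p + 1) * ω / 2) := by
    linear_combination (p * (p + 1) / 2) * h1
  rw [h2, h1]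
  ring

lemma abs_lt_one_of_frequency {n α ω : ℝ} (hn : 0 < n) (hω : α ^ 2 / n ^ 2 < ω) :
    |α / (n * √ω)| < 1 := by
  have hω0 : 0 < ω := lt_of_le_of_lt (by positivity) hω
  rw [← sq_lt_one_iff_abs_lt_one, div_pow, mul_pow, Real.sq_sqrt hω0.le,
    div_lt_one (by positivity)]
  rwa [div_lt_iff₀ (by positivity), mul_comm] at hω

variable {N k : ℕ} {α ω : ℝ}

lemma mem_Ioo_shift_arg (hkN : 2 * k < N) (hω : α ^ 2 / ((N : ℝ) - 2 * k) ^ 2 < ω) :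
    α / ((2 * (k : ℝ) - N) * √ω) ∈ Ioo (-1 : ℝ) 1 := by
  have hn : (0 : ℝ) < (N : ℝ) - 2 * k := by
    rw [sub_pos]
    exact_mod_cast hkN
  have h := abs_lt.mp (abs_lt_one_of_frequency hn hω)
  have e : α / ((2 * (k : ℝ) - N) * √ω) = -(α / (((N : ℝ) - 2 * k) * √ω)) := by
    rw [← div_neg, ← neg_mul, neg_sub]
  rw [e]
  constructor <;> linarith [h.1, h.2]

lemma shift_denom_neg (hkN : 2 * k < N) (hω : 0 < ω) : (2 * (k : ℝ) - N) * √ω < 0 := by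
  refine mul_neg_of_neg_of_pos ?_ (Real.sqrt_pos.mpr hω)
  rw [sub_neg]
  exact_mod_cast hkN

lemma shift_pos (hkN : 2 * k < N) (hω : α ^ 2 / ((N : ℝ) - 2 * k) ^ 2 < ω) (hα : α < 0) :
    0 < shift N k α ω :=
  Real.artanh_pos ⟨div_pos_of_neg_of_neg hα
    (shift_denom_neg hkN (lt_of_le_of_lt (by positivity) hω)), (mem_Ioo_shift_arg hkN hω).2⟩

lemma shift_neg (hkN : 2 * k < N) (hω : α ^ 2 / ((N : ℝ) - 2 * k) ^ 2 < ω) (hα : 0 < α) :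
    shift N k α ω < 0 :=
  Real.artanh_neg ⟨(mem_Ioo_shift_arg hkN hω).1, div_neg_of_pos_of_neg hα
    (shift_denom_neg hkN (lt_of_le_of_lt (by positivity) hω))⟩

lemma riccati_neg_zero (β σ s : ℝ) : riccati β σ (-s) 0 = -riccati β σ s 0 := by
  simp only [riccati, mul_zero, zero_add, Real.sinh_neg, Real.cosh_neg]
  ring

/-- Since r(0) is odd in the shift, the k edges with shift -a_k cancel k of the N - k edges with
shift a_k. -/
lemma sum_riccati_edgeShift (hkN : 2 * k < N) (β σ : ℝ) :
    ∑ j, riccati β σ (edgeShift N k α ω j) 0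
      = ((N : ℝ) - 2 * k) * riccati β σ (shift N k α ω) 0 := by
  set ρ := riccati β σ (shift N k α ω) 0 with hρ
  have e : ∀ j : Fin N, riccati β σ (edgeShift N k α ω j) 0
      = (fun i : ℕ => if i < k then -ρ else ρ) j := by
    intro j
    simp only [edgeShift]
    split_ifs
    · rw [riccati_neg_zero]
    · rfl
  rw [Finset.sum_congr rfl fun j _ => e j,
    Fin.sum_univ_eq_sum_range (fun i : ℕ => if i < k then -ρ else ρ) N]
  obtain ⟨m, hm⟩ := Nat.exists_eq_add_of_le (show k ≤ N by omega)
  rw [hm, Finset.sum_range_add, Finset.sum_congr rfl fun i hi => if_pos (Finset.mem_range.mp hi),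
    Finset.sum_congr rfl fun i _ => if_neg (Nat.not_lt.mpr (Nat.le_add_right k i))]
  simp only [Finset.sum_const, Finset.card_range, nsmul_eq_mul]
  push_cast
  ring

/-- The choice of a_k makes the term -σ tanh a_k contribute exactly α after multiplication by N -
2k; the remaining term β/(sinh a_k cosh a_k) is negative because a_k < 0. -/
lemma sum_riccati_edgeShift_le {β : ℝ} (hβ : 0 < β) (hkN : 2 * k < N)
    (hω : α ^ 2 / ((N : ℝ) - 2 * k) ^ 2 < ω) (hα : 0 < α) :
    ∑ j, riccati β √ω (edgeShift N k α ω j) 0 ≤ α := by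
  have hω0 : 0 < ω := lt_of_le_of_lt (by positivity) hω
  have hd := shift_denom_neg hkN hω0
  have hn : (0 : ℝ) ≤ (N : ℝ) - 2 * k := by
    rw [sub_nonneg]
    exact_mod_cast hkN.le
  rw [sum_riccati_edgeShift hkN]
  have ht : Real.sinh (shift N k α ω) / Real.cosh (shift N k α ω)
      = α / ((2 * (k : ℝ) - N) * √ω) := by
    rw [← Real.tanh_eq_sinh_div_cosh, shift, Real.tanh_artanh (mem_Ioo_shift_arg hkN hω)]
  have hS : Real.sinh (shift N k α ω) < 0 := Real.sinh_neg_iff.mpr (shift_neg hkN hω hα)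
  have hC := Real.cosh_pos (shift N k α ω)
  have h1 : β / (Real.sinh (shift N k α ω) * Real.cosh (shift N k α ω)) ≤ 0 :=
    div_nonpos_of_nonneg_of_nonpos hβ.le (mul_neg_of_neg_of_pos hS hC).le
  have h2 : ((N : ℝ) - 2 * k) * (√ω * (α / ((2 * (k : ℝ) - N) * √ω))) = -α := by
    have e : ((N : ℝ) - 2 * k) * (√ω * (α / ((2 * (k : ℝ) - N) * √ω)))
        = -(α * (((2 * (k : ℝ) - N) * √ω) / ((2 * (k : ℝ) - N) * √ω))) := by ring
    rw [e, div_self hd.ne, mul_one]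
  simp only [riccati, mul_zero, zero_add]
  rw [ht, mul_sub, h2]
  linarith [mul_nonpos_of_nonneg_of_nonpos hn h1]

end Profile

end StarGraph

end

/-! ### The theorem -/

open StarGraph

theorem mainTheorem7 {𝕜 : Type*} [RCLike 𝕜] (N k : ℕ) (p α ω : ℝ)
    (hp : 1 < p) (hα : α ≠ 0) (hk : 1 ≤ k) (hkN : k ≤ (N - 1) / 2)
    (hω : α ^ 2 / ((N : ℝ) - 2 * k) ^ 2 < ω) :
    (α < 0 → StarGraph.morseIndex (StarGraph.L1 𝕜 N k p α ω) ≤ ((k + 1 : ℕ) : ℕ∞)) ∧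
    (0 < α → StarGraph.morseIndex (StarGraph.L1 𝕜 N k p α ω) ≤ ((N - k : ℕ) : ℕ∞)) := by
  -- The subtraction N - 1 is truncated; 1 ≤ k excludes N = 0.
  have hkN' : 2 * k < N := by omega
  have hω0 : 0 < ω := lt_of_le_of_lt (by positivity) hω
  have hβ : 0 < (p - 1) * √ω / 2 := by
    have : 0 < p - 1 := by linarith
    positivity
  have hs0 : shift N k α ω ≠ 0 := by
    rcases lt_or_gt_of_ne hα with h | h
    · exact (shift_pos hkN' hω h).ne'
    · exact (shift_neg hkN' hω h).ne
  have hs : ∀ j, edgeShift N k α ω j ≠ 0 := by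
    intro j
    unfold edgeShift
    split_ifs
    · exact neg_ne_zero.mpr hs0
    · exact hs0
  rw [L1, potential_eq_poschlTeller hp hω0]
  have hq : ∀ j : Fin N,
      Continuous (poschlTeller ((p - 1) * √ω / 2) √ω (edgeShift N k α ω j)) :=
    fun j => continuous_poschlTeller _ _ _
  refine ⟨fun hα => ?_, fun hα => ?_⟩
  · have ha := shift_pos hkN' hω hα
    -- `none` stands for the vertex, seen from edge 0 (any edge would do, by continuity at the
    -- vertex), and `some i` for the zero a_k/β of φ' on one of the first k edges.
    refine (morseIndex_schrodinger_le_card (ι := Option (Fin k)) hq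
      (fun i => i.elim ⟨0, by omega⟩ (Fin.castLE (by omega)))
      (fun i => i.elim 0 fun _ => shift N k α ω / ((p - 1) * √ω / 2))
      (fun i => ?_) fun V W hVW hV => ?_).trans_eq (by simp)
    · cases i
      · exact le_rfl
      · exact (div_pos ha hβ).le
    · refine hVW.re_inner_nonneg hβ hs (fun j hj F hF hVF => ?_)
        (Or.inr ⟨⟨0, by omega⟩, fun F hF hVF => hV none F hF hVF⟩)
      unfold edgeShift at hj ⊢
      split_ifs at hj ⊢ with hjk
      · rw [neg_neg]
        exact hV (some ⟨j, hjk⟩) F hF hVF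
      · exact absurd hj ha.not_gt
  · have ha := shift_neg hkN' hω hα
    -- One condition for each edge of index at least k: the zero -a_k/β of φ', positive because a_k
    -- < 0.
    refine (morseIndex_schrodinger_le_card (ι := Fin (N - k)) hq
      (fun i => ⟨k + i, by omega⟩) (fun _ => -shift N k α ω / ((p - 1) * √ω / 2))
      (fun i => (div_pos (neg_pos.mpr ha) hβ).le) fun V W hVW hV => ?_).trans_eq (by simp)
    refine hVW.re_inner_nonneg hβ hs (fun j hj F hF hVF => ?_)
      (Or.inl (sum_riccati_edgeShift_le hβ hkN' hω hα))
    unfold edgeShift at hj ⊢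
    split_ifs at hj ⊢ with hjk
    · exact absurd hj (neg_pos.mpr ha).not_gt
    · have e : (⟨k + (j - k), by omega⟩ : Fin N) = j := Fin.ext (by simp only; omega)
      refine hV ⟨j - k, by omega⟩ F hF ?_
      simp only [e]
      exact hVF
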